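/- Let $d\ge 1$, let $\Omega\subset\mathbb{R}^d$ be open and $0<T<\infty$. Let $u\in L^\infty(\Omega\times(0,T);\mathbb{R}^d)$, $p\in L^1(\Omega\times(0,T))$ and $f\in L^1(\Omega\times(0,T);\mathbb{R}^d)$, and suppose that $(u,p)$ is a weak solution of the incompressible Euler equations with force $f$, that is, $$\partial_t u+\operatorname{div}(u\otimes u)+\nabla p=f,\qquad \operatorname{div}u=0\qquad\text{in }\mathcal{D}'(\Omega\times(0,T)).$$ Write $u_t=u(\cdot,t)$. Assume that the spatial antisymmetric gradient $\Lambda u=\nabla u-(\nabla u)^T$ lies in $L^1_t\mathcal{M}_x$: there is a weakly measurable curve $t\mapsto\Lambda u_t$ of $\mathbb{R}^{d\times d}$-valued Radon measures on $\Omega$ with $\int_0^T|\Lambda u_t|(\Omega)\,dt<\infty$ such that, for a.e. $t\in(0,T)$ and all $i,j$, $(\Lambda u_t)_{ij}=\partial_j (u_t)_i-\partial_i (u_t)_j$ in $\mathcal{D}'(\Omega)$. Here $|\Lambda u_t|$ denotes the total variation measure. We say that a locally integrable $w:\Omega\to\mathbb{R}^d$ admits a blow up at $x_0\in\Omega$ if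 there is $v\in L^1(B_1;\mathbb{R}^d)$, $B_1$ being the open unit ball, with $$\lim_{\ell\to0^+}\int_{B_1}|w(x_0+\ell z)-v(z)|\,dz=0,$$ and we let $\mathcal{N}_w$ be the set of the points of $\Omega$ at which $w$ admits no blow up. Assume that $|\Lambda u_t|(\mathcal{N}_{u_t})=0$ for a.e. $t\in(0,T)$. Let $\mathrm{D}\in\mathcal{D}'(\Omega\times(0,T))$ be the defect distribution of the local energy balance, defined by $$\partial_t\frac{|u|^2}{2}+\operatorname{div}\left(u\left(\frac{|u|^2}{2}+p\right)\right)=-\mathrm{D}+f\cdot u\qquad\text{in }\mathcal{D}'(\Omega\times(0,T)).$$ Then $\mathrm{D}\equiv0$. -/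

import Mathlib

open MeasureTheory Set Filter Topology TopologicalSpace
open scoped Distributions LineDeriv ENNReal

namespace EulerEnergy

/-- The Euclidean space `ℝ^d`. -/
abbrev Space (d : ℕ) : Type := EuclideanSpace ℝ (Fin d)

/-- The matrices `ℝ^{d × d}`, with the Euclidean (Frobenius) norm. -/
abbrev Mat (d : ℕ) : Type := EuclideanSpace ℝ (Fin d × Fin d)

/-- The open space-time cylinder over `Ω` and the time interval `(0,T)`; a space-time point is
written `(t, x)`. -/
def cylinder {d : ℕ} (Ω : Opens (Space d)) (T : ℝ) : Opens (ℝ × Space d) :=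
  ⟨Ioo 0 T ×ˢ (Ω : Set (Space d)), isOpen_Ioo.prod Ω.isOpen⟩

/-- The distribution `φ ↦ ∫ φ g` on the open set `U` given by a function `g` that is locally
integrable on `U`. -/
noncomputable def toDistribution {X : Type*} [NormedAddCommGroup X] [NormedSpace ℝ X]
    [MeasureSpace X] [OpensMeasurableSpace X] (U : Opens X) (g : X → ℝ) : 𝓓'(U, ℝ) :=
  ContinuousLinearMap.toUniformConvergenceCLM (RingHom.id ℝ) ℝ _
    (TestFunction.integralAgainstBilinCLM (ContinuousLinearMap.lsmul ℝ ℝ) volume g)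

/-- The unit vector of `ℝ^d` in direction `i`. -/
noncomputable def e {d : ℕ} (i : Fin d) : Space d := EuclideanSpace.single i 1

/-- The time derivative of a space-time distribution. -/
noncomputable def dt {d : ℕ} {U : Opens (ℝ × Space d)} (S : 𝓓'(U, ℝ)) : 𝓓'(U, ℝ) :=
  ∂_{((1, 0) : ℝ × Space d)} S

/-- The derivative of a space-time distribution in the `i`-th space direction. -/
noncomputable def dx {d : ℕ} {U : Opens (ℝ × Space d)} (i : Fin d) (S : 𝓓'(U, ℝ)) : 𝓓'(U, ℝ) :=
  ∂_{((0, e i) : ℝ × Space d)} S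

/-- `(u, p)` solves `∂ₜ u + div (u ⊗ u) + ∇ p = f`, `div u = 0` in the sense of distributions on
`Ω × (0,T)`. -/
structure IsWeakSolution {d : ℕ} (Ω : Opens (Space d)) (T : ℝ)
    (u : ℝ → Space d → Space d) (p : ℝ → Space d → ℝ) (f : ℝ → Space d → Space d) : Prop where
  momentum : ∀ i : Fin d,
    dt (toDistribution (cylinder Ω T) fun z => u z.1 z.2 i)
      + ∑ j : Fin d, dx j (toDistribution (cylinder Ω T) fun z => u z.1 z.2 i * u z.1 z.2 j)
      + dx i (toDistribution (cylinder Ω T) fun z => p z.1 z.2)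
    = toDistribution (cylinder Ω T) fun z => f z.1 z.2 i
  incompressible :
    ∑ i : Fin d, dx i (toDistribution (cylinder Ω T) fun z => u z.1 z.2 i) = 0

/-- The defect distribution `D` of the local energy balance
`∂ₜ (|u|² / 2) + div (u (|u|² / 2 + p)) = - D + f ⬝ u`. -/
noncomputable def dissipation {d : ℕ} (Ω : Opens (Space d)) (T : ℝ)
    (u : ℝ → Space d → Space d) (p : ℝ → Space d → ℝ) (f : ℝ → Space d → Space d) :
    𝓓'(cylinder Ω T, ℝ) :=
  toDistribution (cylinder Ω T) (fun z => inner ℝ (f z.1 z.2) (u z.1 z.2))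
    - dt (toDistribution (cylinder Ω T) fun z => ‖u z.1 z.2‖ ^ 2 / 2)
    - ∑ i : Fin d, dx i (toDistribution (cylinder Ω T)
        fun z => u z.1 z.2 i * (‖u z.1 z.2‖ ^ 2 / 2 + p z.1 z.2))

/-- `w` admits a blow up at `x₀`: the rescalings `z ↦ w (x₀ + ℓ z)` converge in `L¹` of the unit
ball as `ℓ → 0⁺` (for `x₀` in an open set `Ω`, only values of `w` in `Ω` matter). -/
def AdmitsBlowUp {d : ℕ} (w : Space d → Space d) (x₀ : Space d) : Prop :=
  ∃ v : Space d → Space d, IntegrableOn v (Metric.ball 0 1) ∧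
    Tendsto (fun ℓ : ℝ => ∫⁻ z in Metric.ball (0 : Space d) 1, ‖w (x₀ + ℓ • z) - v z‖ₑ)
      (𝓝[>] 0) (𝓝 0)

/-- The set `N_w` of the points of `Ω` at which `w` admits no blow up. -/
def noBlowUpSet {d : ℕ} (Ω : Opens (Space d)) (w : Space d → Space d) : Set (Space d) :=
  {x | x ∈ Ω ∧ ¬ AdmitsBlowUp w x}

/-- `μ ∈ L¹((0,T); M(Ω; ℝ^{d × d}))`: a weakly measurable curve of measures on `Ω` with integrable
total variation norm. A measure on `Ω` is represented by a vector measure on `ℝ^d`, of which only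
the restriction to `Ω` matters. -/
structure MemL1Measures {d : ℕ} (Ω : Opens (Space d)) (T : ℝ)
    (μ : ℝ → VectorMeasure (Space d) (Mat d)) : Prop where
  weaklyMeasurable : ∀ φ : Space d → ℝ, Continuous φ → HasCompactSupport φ →
    tsupport φ ⊆ (Ω : Set (Space d)) →
    AEStronglyMeasurable (fun t => ∫ᵛ x, φ x ∂•(μ t)) (volume.restrict (Ioo 0 T))
  integrableNorm : ∫⁻ t in Ioo 0 T, (μ t).variation (Ω : Set (Space d)) < ∞

/-- The measure `μ` is the distributional antisymmetric gradient of `w` on `Ω`: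
`μ i j = ∂ⱼ wᵢ - ∂ᵢ wⱼ` in the sense of distributions. -/
def IsAntisymmGradient {d : ℕ} (Ω : Opens (Space d)) (w : Space d → Space d)
    (μ : VectorMeasure (Space d) (Mat d)) : Prop :=
  ∀ (i j : Fin d) (φ : 𝓓(Ω, ℝ)),
    (∂_{e j} (toDistribution Ω fun x => w x i) - ∂_{e i} (toDistribution Ω fun x => w x j)) φ
      = (∫ᵛ x, φ x ∂•μ) (i, j)

end EulerEnergy

/-! For smooth `u` the energy balance comes from multiplying the momentum equation by `u`; the cubic
term closes because `div (u ⊗ u) - ∇ |u|² / 2 = (Λu) u`, and `(Λu) u · u = 0` by antisymmetry. The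
proof makes sense of this product when `Λu` is only a measure. Mollifications of `u_t` at radius `1
/ (n + 1)` all use one profile, so they converge at every blow up point, hence `|Λu_t|`-almost
everywhere. The limit `preciseValue` is bounded and can be integrated against `Λu_t`. It need not be
a Lebesgue value: any bounded pointwise limit common to all factors suffices.

At a fixed time, `IsSlice.integral_advectionDensity` is the weak form of the identity above: `∫ ½
|w|² div Ψ - (w ⊗ w) : ∇Ψ` equals the sum over `i, j` of the integrals of `Ψ i * preciseValue w j`
against `μ i j`. Its size is therefore controlled by `sup |Ψ|` and `|μ|`, without derivatives of
`Ψ`. Inserting the mollified field `Ψ i = symMollify k φ (w i)`, which tends to `2 φ` times the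
precise value, leaves in the limit a symmetric tensor integrated against an antisymmetric measure,
hence zero (`IsSlice.tendsto_integral_advectionDensity`).

In space-time, the momentum equation is tested with `symMollify k φ (U i) = φ (k * U i) + k * (φ U
i)`. For an even kernel, the derivatives that fall on `k` cancel in the time term; for a divergence
free field they also disappear from the divergence of the test field, which handles the pressure and
the kinetic energy. The kernel is first a tensor product of a time and a space kernel, and the time
scale is sent to zero alone (`energy_mollified_slice`), so no regularity in time is needed. The only
remaining term is the time integral of the fixed-time quantity above, dominated by a multiple of
`|Λu_t|(O)`; it vanishes by dominated convergence (`energy_mollified`, `energy_balance`). -/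

namespace EulerEnergy

open scoped ContDiff

set_option linter.unusedSectionVars false

/-! ### Test functions, mollification and its symmetrized version. -/

section Mollification

variable {E : Type*} [NormedAddCommGroup E] [NormedSpace ℝ E]

/-- The derivative of `f` in direction `v`. -/
noncomputable def dirDeriv (v : E) (f : E → ℝ) : E → ℝ := fun x => fderiv ℝ f x v

/-- `f` is smooth with compact support contained in `O`. -/
structure IsTest (O : Set E) (f : E → ℝ) : Prop where
  smooth : ContDiff ℝ ∞ f
  compact : HasCompactSupport f
  subset : tsupport f ⊆ O

namespace IsTest

variable {O O' : Set E} {f g : E → ℝ}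

theorem mono (hf : IsTest O f) (h : O ⊆ O') : IsTest O' f :=
  ⟨hf.smooth, hf.compact, hf.subset.trans h⟩

theorem continuous (hf : IsTest O f) : Continuous f := hf.smooth.continuous

theorem differentiable (hf : IsTest O f) : Differentiable ℝ f :=
  hf.smooth.differentiable (by simp)

theorem dirDeriv (hf : IsTest O f) (v : E) : IsTest O (dirDeriv v f) :=
  ⟨(hf.smooth.fderiv_right (m := ∞) (by simp)).clm_apply contDiff_const,
    hf.compact.fderiv_apply (𝕜 := ℝ) v, (tsupport_fderiv_apply_subset ℝ v).trans hf.subset⟩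

theorem mul_left (hf : IsTest O f) (hg : ContDiff ℝ ∞ g) : IsTest O (fun x => g x * f x) :=
  ⟨hg.mul hf.smooth, hf.compact.mul_left, (tsupport_mul_subset_right).trans hf.subset⟩

theorem mul_right (hf : IsTest O f) (hg : ContDiff ℝ ∞ g) : IsTest O (fun x => f x * g x) :=
  ⟨hf.smooth.mul hg, hf.compact.mul_right, (tsupport_mul_subset_left).trans hf.subset⟩

theorem add (hf : IsTest O f) (hg : IsTest O g) : IsTest O (fun x => f x + g x) :=
  ⟨hf.smooth.add hg.smooth, hf.compact.add hg.compact,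
    (tsupport_add f g).trans (union_subset hf.subset hg.subset)⟩

theorem exists_bound (hf : IsTest O f) : ∃ C, 0 ≤ C ∧ ∀ x, |f x| ≤ C := by
  obtain ⟨C, hC⟩ := hf.continuous.bounded_above_of_compact_support hf.compact
  exact ⟨C, (norm_nonneg _).trans (hC 0), hC⟩

theorem eq_zero (hf : IsTest O f) {x : E} (hx : x ∉ O) : f x = 0 :=
  image_eq_zero_of_notMem_tsupport fun h => hx (hf.subset h)

theorem sub_left {r : ℝ} (hf : IsTest (Metric.closedBall 0 r) f) (x : E) :
    IsTest (Metric.closedBall x r) (fun y => f (x - y)) := by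
  refine ⟨hf.smooth.comp (contDiff_const.sub contDiff_id), ?_, ?_⟩
  · exact hf.compact.comp_homeomorph (Homeomorph.subLeft x)
  · refine closure_minimal (fun y hy => ?_) Metric.isClosed_closedBall
    have := hf.subset (subset_tsupport f hy)
    simpa [dist_eq_norm, norm_sub_rev] using this

end IsTest

theorem dirDeriv_sub_left {f : E → ℝ} (hf : Differentiable ℝ f) (v x y : E) :
    dirDeriv v (fun y => f (x - y)) y = - dirDeriv v f (x - y) := by
  have h : HasFDerivAt (fun y => f (x - y)) ((fderiv ℝ f (x - y)).comp (-ContinuousLinearMap.id ℝ E)) y :=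
    (hf (x - y)).hasFDerivAt.comp y ((hasFDerivAt_id y).const_sub x)
  simp [dirDeriv, h.fderiv]

theorem dirDeriv_mul {f g : E → ℝ} (hf : Differentiable ℝ f) (hg : Differentiable ℝ g) (v x : E) :
    dirDeriv v (fun y => f y * g y) x = dirDeriv v f x * g x + f x * dirDeriv v g x := by
  simp only [dirDeriv]
  rw [fderiv_fun_mul (hf x) (hg x)]
  simp
  ring

theorem dirDeriv_add {f g : E → ℝ} (hf : Differentiable ℝ f) (hg : Differentiable ℝ g) (v x : E) :
    dirDeriv v (fun y => f y + g y) x = dirDeriv v f x + dirDeriv v g x := by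
  simp only [dirDeriv]
  rw [fderiv_fun_add (hf x) (hg x)]
  simp

variable [MeasureSpace E]

/-- The convolution `∫ k (x - y) g y dy` of `g` with the kernel `k`. -/
noncomputable def mollify (k g : E → ℝ) (x : E) : ℝ := ∫ y, k (x - y) * g y

theorem mollify_eq_convolution (k g : E → ℝ) :
    mollify k g = convolution g k (ContinuousLinearMap.lsmul ℝ ℝ) volume := by
  ext x
  simp [mollify, convolution, mul_comm]

variable [BorelSpace E] [FiniteDimensional ℝ E] [(volume : Measure E).IsAddHaarMeasure]
  {O : Set E} {k g : E → ℝ}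

theorem IsTest.integrable (hk : IsTest O k) : Integrable k :=
  hk.continuous.integrable_of_hasCompactSupport hk.compact

theorem IsTest.integrable_mul (hk : IsTest O k) (hg : Integrable g) :
    Integrable (fun x => k x * g x) := by
  obtain ⟨C, -, hC⟩ := hk.exists_bound
  exact hg.bdd_mul hk.continuous.aestronglyMeasurable (Eventually.of_forall hC)

theorem IsTest.integrable_mollify (hk : IsTest O k) (hg : Integrable g) (x : E) :
    Integrable (fun y => k (x - y) * g y) := by
  obtain ⟨C, -, hC⟩ := hk.exists_bound
  exact hg.bdd_mul (hk.continuous.comp (continuous_sub_left x)).aestronglyMeasurable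
    (Eventually.of_forall fun y => hC _)

theorem IsTest.contDiff_mollify (hk : IsTest O k) (hg : Integrable g) :
    ContDiff ℝ ∞ (mollify k g) := by
  rw [mollify_eq_convolution]
  exact hk.compact.contDiff_convolution_right (n := ⊤) _ hg.locallyIntegrable hk.smooth

theorem IsTest.dirDeriv_mollify (hk : IsTest O k) (hg : Integrable g) (v : E) :
    EulerEnergy.dirDeriv v (EulerEnergy.mollify k g)
      = EulerEnergy.mollify (EulerEnergy.dirDeriv v k) g := by
  ext x
  rw [mollify_eq_convolution, mollify_eq_convolution, EulerEnergy.dirDeriv]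
  have hk1 : ContDiff ℝ 1 k := hk.smooth.of_le (by exact_mod_cast le_top)
  rw [(hk.compact.hasFDerivAt_convolution_right _ hg.locallyIntegrable hk1 x).fderiv,
    convolution_precompR_apply _ hg.locallyIntegrable (hk.compact.fderiv ℝ)
      (hk1.continuous_fderiv one_ne_zero)]
  rfl

theorem IsTest.mollify {r : ℝ} (hk : IsTest (Metric.closedBall 0 r) k) (hg : Integrable g)
    {S : Set E} (hS : IsCompact S) (hgS : ∀ x ∉ S, g x = 0) :
    IsTest (Metric.cthickening r S) (mollify k g) := by
  have hz : ∀ x ∉ Metric.cthickening r S, EulerEnergy.mollify k g x = 0 := by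
    intro x hx
    refine integral_eq_zero_of_ae (Eventually.of_forall fun y => ?_)
    by_cases hy : y ∈ S
    · have : k (x - y) = 0 := by
        refine hk.eq_zero fun h => hx ?_
        refine Metric.mem_cthickening_of_dist_le x y r S hy ?_
        simpa [dist_eq_norm] using h
      simp [this]
    · simp [hgS y hy]
  have hsub : tsupport (EulerEnergy.mollify k g) ⊆ Metric.cthickening r S :=
    closure_minimal (fun x hx => by_contra fun h => hx (hz x h)) Metric.isClosed_cthickening
  exact ⟨hk.contDiff_mollify hg, (hS.cthickening).of_isClosed_subset (isClosed_tsupport _) hsub, hsub⟩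

theorem abs_mollify_le (hk : Integrable k) {C : ℝ} (hg : ∀ x, |g x| ≤ C) (x : E) :
    |mollify k g x| ≤ C * ∫ z, |k z| := by
  have h : ∫ y, |k (x - y)| = ∫ z, |k z| := integral_sub_left_eq_self (fun z => |k z|) volume x
  rw [← h, ← integral_const_mul, mollify, ← Real.norm_eq_abs]
  refine norm_integral_le_of_norm_le ((hk.abs.comp_sub_left x).const_mul C)
    (Eventually.of_forall fun y => ?_)
  rw [Real.norm_eq_abs, abs_mul, mul_comm]
  exact mul_le_mul_of_nonneg_right (hg y) (abs_nonneg _)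

/-- Fubini: exchanging the two variables reverses the argument of the kernel, at the cost of its
parity `s`. Derivatives of an even kernel have `s = -1`, so convolution with them is skew-adjoint.
-/
theorem IsTest.integral_mul_mollify (hk : IsTest O k) {s : ℝ} (hs : ∀ z, k (-z) = s * k z)
    {a b : E → ℝ} (ha : Integrable a) (hb : Integrable b) :
    ∫ x, a x * EulerEnergy.mollify k b x = s * ∫ x, EulerEnergy.mollify k a x * b x := by
  obtain ⟨C, -, hC⟩ := hk.exists_bound
  have hint : Integrable (fun z : E × E => a z.1 * (k (z.1 - z.2) * b z.2))
      ((volume : Measure E).prod volume) := by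
    have : Integrable (fun z : E × E => k (z.1 - z.2) * (a z.1 * b z.2))
        ((volume : Measure E).prod volume) :=
      (ha.mul_prod hb).bdd_mul (hk.continuous.comp (continuous_fst.sub continuous_snd)).aestronglyMeasurable
        (Eventually.of_forall fun z => hC _)
    exact this.congr (Eventually.of_forall fun z => by ring)
  calc ∫ x, a x * EulerEnergy.mollify k b x = ∫ x, ∫ y, a x * (k (x - y) * b y) := by
        simp only [EulerEnergy.mollify, integral_const_mul]
    _ = ∫ y, ∫ x, a x * (k (x - y) * b y) := integral_integral_swap hint
    _ = ∫ y, s * (EulerEnergy.mollify k a y * b y) := by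
        refine integral_congr_ae (Eventually.of_forall fun y => ?_)
        simp only [EulerEnergy.mollify]
        rw [← mul_assoc, ← integral_const_mul, ← integral_mul_const]
        refine integral_congr_ae (Eventually.of_forall fun x => ?_)
        have := hs (y - x)
        rw [neg_sub] at this
        simp only [this]
        ring
    _ = _ := integral_const_mul _ _

/-- A commutator estimate: the two terms differ by the factor `ψ y - ψ x`, which only matters within
the kernel radius `r`. -/
theorem abs_mollify_mul_sub_le {r : ℝ} (hk : IsTest (Metric.closedBall 0 r) k) (hg : Integrable g)
    {C w : ℝ} (hgC : ∀ x, |g x| ≤ C) {ψ : E → ℝ} (hψ : IsTest O ψ) (x : E)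
    (hw : ∀ y, dist x y ≤ r → |ψ y - ψ x| ≤ w) :
    |mollify k (fun y => ψ y * g y) x - ψ x * mollify k g x| ≤ w * C * ∫ z, |k z| := by
  have h : ∫ y, |k (x - y)| = ∫ z, |k z| :=
    integral_sub_left_eq_self (fun z => |k z|) volume x
  rw [mollify, mollify, ← integral_const_mul,
    ← integral_sub (hk.integrable_mollify (hψ.integrable_mul hg) x)
      ((hk.integrable_mollify hg x).const_mul _), ← h, ← integral_const_mul, ← Real.norm_eq_abs]
  refine norm_integral_le_of_norm_le ((hk.integrable.abs.comp_sub_left x).const_mul _)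
    (Eventually.of_forall fun y => ?_)
  have e1 : k (x - y) * (ψ y * g y) - ψ x * (k (x - y) * g y)
      = (ψ y - ψ x) * g y * k (x - y) := by ring
  rw [e1, Real.norm_eq_abs, abs_mul, abs_mul]
  by_cases hy : dist x y ≤ r
  · have := hw y hy
    gcongr
    · exact (abs_nonneg _).trans this
    · exact hgC y
  · have : k (x - y) = 0 := hk.eq_zero fun h => hy (by simpa [dist_eq_norm] using h)
    simp [this]

theorem dirDeriv_even {k : E → ℝ} (hk : Differentiable ℝ k) (he : ∀ z, k (-z) = k z) (v z : E) :
    dirDeriv v k (-z) = -1 * dirDeriv v k z := by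
  have h := dirDeriv_sub_left hk v 0 z
  simp only [zero_sub, he] at h
  have h2 : dirDeriv v k z = - dirDeriv v k (-z) := h
  linarith

/-- The symmetrized mollification of the product `ψ g`. -/
noncomputable def symMollify (k ψ g : E → ℝ) (x : E) : ℝ :=
  ψ x * mollify k g x + mollify k (fun y => ψ y * g y) x

variable {ψ : E → ℝ}

theorem dirDeriv_symMollify (hk : IsTest O k) (hψ : IsTest univ ψ) (hg : Integrable g) (v x : E) :
    dirDeriv v (symMollify k ψ g) x = dirDeriv v ψ x * mollify k g x
      + (ψ x * mollify (dirDeriv v k) g x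
      + mollify (dirDeriv v k) (fun y => ψ y * g y) x) := by
  have h1 := (hk.contDiff_mollify hg).differentiable (by simp)
  have hψg := hψ.integrable_mul hg
  have h2 := (hk.contDiff_mollify hψg).differentiable (by simp)
  have : symMollify k ψ g = fun x => ψ x * mollify k g x + mollify k (fun y => ψ y * g y) x := rfl
  rw [this, dirDeriv_add (hψ.differentiable.fun_mul h1) h2, dirDeriv_mul hψ.differentiable h1,
    hk.dirDeriv_mollify hg, hk.dirDeriv_mollify hψg, add_assoc]

theorem IsTest.symMollify {r : ℝ} (hk : IsTest (Metric.closedBall 0 r) k) {S : Set E}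
    (hS : IsCompact S) (hψ : IsTest S ψ) (hg : Integrable g) :
    IsTest (Metric.cthickening r S) (symMollify k ψ g) := by
  refine (((hψ.mul_right (hk.contDiff_mollify hg)).mono ?_).add
    (hk.mollify (hψ.integrable_mul hg) hS fun x hx => by simp [hψ.eq_zero hx]))
  exact Metric.self_subset_cthickening S

theorem IsTest.exists_bound_mollify (hk : IsTest O k) (hg : Integrable g) :
    ∃ C, ∀ x, |EulerEnergy.mollify k g x| ≤ C := by
  obtain ⟨C, -, hC⟩ := hk.exists_bound
  refine ⟨∫ y, C * |g y|, fun x => ?_⟩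
  rw [EulerEnergy.mollify, ← Real.norm_eq_abs]
  refine norm_integral_le_of_norm_le (hg.abs.const_mul C) (Eventually.of_forall fun y => ?_)
  rw [Real.norm_eq_abs, abs_mul]
  exact mul_le_mul_of_nonneg_right (hC _) (abs_nonneg _)

theorem IsTest.integrable_mul_mollify (hk : IsTest O k) (hg : Integrable g) {a : E → ℝ}
    (ha : Integrable a) : Integrable (fun x => a x * EulerEnergy.mollify k g x) := by
  obtain ⟨C, hC⟩ := hk.exists_bound_mollify hg
  exact ha.mul_bdd (hk.contDiff_mollify hg).continuous.aestronglyMeasurable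
    (Eventually.of_forall hC)

/-- The two terms with a derivative on the kernel cancel, by skew-adjointness. This is the reason
for symmetrizing: the right-hand side survives the concentration of the kernel for merely bounded
`g`. -/
theorem integral_mul_dirDeriv_symMollify (hk : IsTest O k) (he : ∀ z, k (-z) = k z)
    (hψ : IsTest univ ψ) (hg : Integrable g) (v : E) :
    ∫ x, g x * dirDeriv v (symMollify k ψ g) x
      = ∫ x, dirDeriv v ψ x * (g x * mollify k g x) := by
  have hψg := hψ.integrable_mul hg
  have hdk := hk.dirDeriv v
  have h1 := (hψ.dirDeriv v).integrable_mul (hk.integrable_mul_mollify hg hg)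
  have h2 := hdk.integrable_mul_mollify hg hψg
  have h3 := hdk.integrable_mul_mollify hψg hg
  have e1 : ∀ x, g x * dirDeriv v (symMollify k ψ g) x
      = dirDeriv v ψ x * (g x * mollify k g x) + ((ψ x * g x) * mollify (dirDeriv v k) g x
        + g x * mollify (dirDeriv v k) (fun y => ψ y * g y) x) := fun x => by
    rw [dirDeriv_symMollify hk hψ hg]; ring
  have h4 := hdk.integral_mul_mollify (s := -1) (dirDeriv_even hk.differentiable he v) hψg hg
  have h5 : ∫ x, mollify (dirDeriv v k) (fun y => ψ y * g y) x * g x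
      = ∫ x, g x * mollify (dirDeriv v k) (fun y => ψ y * g y) x := by simp only [mul_comm]
  simp only [e1]
  rw [integral_add h1 (by exact h2.add h3), integral_add h2 h3, h4, h5]
  ring

theorem abs_symMollify_sub_le {r : ℝ} (hk : IsTest (Metric.closedBall 0 r) k) (hg : Integrable g)
    {C w : ℝ} (hgC : ∀ x, |g x| ≤ C) (hψ : IsTest O ψ) (x : E)
    (hw : ∀ y, dist x y ≤ r → |ψ y - ψ x| ≤ w) :
    |symMollify k ψ g x - 2 * (ψ x * mollify k g x)| ≤ w * C * ∫ z, |k z| := by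
  have := abs_mollify_mul_sub_le hk hg hgC hψ x hw
  rwa [show symMollify k ψ g x - 2 * (ψ x * mollify k g x)
    = mollify k (fun y => ψ y * g y) x - ψ x * mollify k g x by rw [symMollify]; ring]

theorem abs_symMollify_le (hk : Integrable k) {C A : ℝ} (hgC : ∀ x, |g x| ≤ C)
    (hψA : ∀ x, |ψ x| ≤ A) (x : E) :
    |symMollify k ψ g x| ≤ 2 * (A * (C * ∫ z, |k z|)) := by
  have hA : 0 ≤ A := (abs_nonneg _).trans (hψA x)
  have h1 := abs_mollify_le hk hgC x
  have h2 : ∀ y, |ψ y * g y| ≤ A * C := fun y => by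
    rw [abs_mul]
    exact mul_le_mul (hψA y) (hgC y) (abs_nonneg _) hA
  have h3 := abs_mollify_le hk h2 x
  calc _ ≤ |ψ x * mollify k g x| + |mollify k (fun y => ψ y * g y) x| := abs_add_le _ _
    _ ≤ A * (C * ∫ z, |k z|) + A * C * ∫ z, |k z| := by
        rw [abs_mul]
        gcongr
        exact hψA x
    _ = _ := by ring

/-- Here the derivatives leave the kernel because `w` is divergence free: `ψ` times the mollified
divergence is zero, and in the other term the derivative moves from `k` to `ψ`. The result has the
form of `symMollify` with `ψ` differentiated. -/
theorem sum_dirDeriv_symMollify {ι : Type*} [Fintype ι] {w : ι → E → ℝ}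
    (hw : ∀ j, Integrable (w j)) (v : ι → E)
    (hdiv : ∀ ζ, IsTest O ζ → ∑ j, ∫ x, w j x * dirDeriv (v j) ζ x = 0) {r : ℝ}
    (hk : IsTest (Metric.closedBall 0 r) k) {S : Set E} (hψ : IsTest S ψ) (hSO : S ⊆ O)
    (hS : ∀ x ∈ S, Metric.closedBall x r ⊆ O) (x : E) :
    ∑ j, dirDeriv (v j) (symMollify k ψ (w j)) x = ∑ j, (dirDeriv (v j) ψ x * mollify k (w j) x
      + mollify k (fun y => dirDeriv (v j) ψ y * w j y) x) := by
  have h1 : ψ x * ∑ j, mollify (dirDeriv (v j) k) (w j) x = 0 := by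
    by_cases hx : x ∈ S
    -- The translated kernel `y ↦ k (x - y)` is itself an admissible test function on `O` when `x ∈
    -- S`.
    · have h := hdiv _ ((hk.sub_left x).mono (hS x hx))
      simp only [dirDeriv_sub_left hk.differentiable, mul_neg, integral_neg,
        Finset.sum_neg_distrib, neg_eq_zero] at h
      simp only [mollify, mul_comm (dirDeriv _ k _)]
      rw [h, mul_zero]
    · rw [hψ.eq_zero hx, zero_mul]
  have h2 : ∑ j, mollify (dirDeriv (v j) k) (fun y => ψ y * w j y) x
      = ∑ j, mollify k (fun y => dirDeriv (v j) ψ y * w j y) x := by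
    have ht := hk.sub_left x
    -- With the factor `ψ`, the test function `y ↦ k (x - y) * ψ y` is supported in `S` for every
    -- `x`.
    have h := hdiv _ ((hψ.mul_left ht.smooth).mono hSO)
    have e1 : ∀ j, ∫ y, w j y * dirDeriv (v j) (fun y => k (x - y) * ψ y) y
        = mollify k (fun y => dirDeriv (v j) ψ y * w j y) x
          - mollify (dirDeriv (v j) k) (fun y => ψ y * w j y) x := fun j => by
      rw [mollify, mollify, ← integral_sub
        (hk.integrable_mollify ((hψ.dirDeriv _).integrable_mul (hw j)) x)
        ((hk.dirDeriv _).integrable_mollify (hψ.integrable_mul (hw j)) x)]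
      refine integral_congr_ae (Eventually.of_forall fun y => ?_)
      simp only
      rw [dirDeriv_mul ht.differentiable hψ.differentiable, dirDeriv_sub_left hk.differentiable]
      ring
    simp only [e1, Finset.sum_sub_distrib] at h
    linarith
  simp only [dirDeriv_symMollify hk (hψ.mono (subset_univ _)) (hw _), Finset.sum_add_distrib,
    ← Finset.mul_sum, h1, h2]
  ring

end Mollification

/-! ### The standard mollifier, its scaling, and convergence at blow up points. -/

section Kernel

variable {E : Type*} [NormedAddCommGroup E] [NormedSpace ℝ E] [HasContDiffBump E]

variable (E) in
/-- A bump function at the origin with support of radius `1 / (n + 1)`. -/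
noncomputable def stdBump (n : ℕ) : ContDiffBump (0 : E) where
  rIn := ((2 : ℝ) * (n + 1))⁻¹
  rOut := ((n : ℝ) + 1)⁻¹
  rIn_pos := by positivity
  rIn_lt_rOut := by
    rw [mul_inv]
    have : (0 : ℝ) < ((n : ℝ) + 1)⁻¹ := by positivity
    linarith

/-- The ratio of outer to inner radius is `2` for every `n`, so all bumps are dilates of a single
profile. Convergence at blow up points depends on this. -/
theorem stdBump_apply (n : ℕ) (z : E) : stdBump E n z = stdBump E 0 (((n : ℝ) + 1) • z) := by
  have h1 : (((n : ℝ) + 1)⁻¹ / ((2 : ℝ) * (n + 1))⁻¹) = 2 := by field_simp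
  simp only [ContDiffBump.apply, stdBump, h1]
  norm_num [smul_smul]

variable [MeasureSpace E] [BorelSpace E] [FiniteDimensional ℝ E]
  [(volume : Measure E).IsAddHaarMeasure]

variable (E) in
/-- The standard mollifier with support of radius `1 / (n + 1)`. -/
noncomputable def kernel (n : ℕ) : E → ℝ := (stdBump E n).normed volume

theorem kernel_isTest (n : ℕ) : IsTest (Metric.closedBall 0 ((n : ℝ) + 1)⁻¹) (kernel E n) :=
  ⟨(stdBump E n).contDiff_normed (n := ⊤), (stdBump E n).hasCompactSupport_normed,
    ((stdBump E n).tsupport_normed_eq).subset⟩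

theorem kernel_neg (n : ℕ) (z : E) : kernel E n (-z) = kernel E n z :=
  (stdBump E n).normed_neg z

theorem kernel_nonneg (n : ℕ) (z : E) : 0 ≤ kernel E n z := (stdBump E n).nonneg_normed z

theorem integral_abs_kernel (n : ℕ) : ∫ z : E, |kernel E n z| = 1 := by
  simp only [abs_of_nonneg (kernel_nonneg n _)]
  exact (stdBump E n).integral_normed

theorem kernel_scaling (n : ℕ) (z : E) :
    kernel E n z = ((n : ℝ) + 1) ^ Module.finrank ℝ E * kernel E 0 (((n : ℝ) + 1) • z) := by
  have h0 : (0 : ℝ) < (n : ℝ) + 1 := by positivity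
  have h : ∫ z, stdBump E n z = (((n : ℝ) + 1) ^ Module.finrank ℝ E)⁻¹ * ∫ z, stdBump E 0 z := by
    simp only [stdBump_apply n]
    rw [Measure.integral_comp_smul]
    simp [abs_of_pos h0]
  simp only [kernel, ContDiffBump.normed_def, h]
  rw [stdBump_apply n z]
  field_simp

theorem mollify_kernel (n : ℕ) (w : E → ℝ) (x : E) :
    mollify (kernel E n) w x = ∫ z, kernel E 0 z * w (x + ((n : ℝ) + 1)⁻¹ • z) := by
  have h0 : (0 : ℝ) < (n : ℝ) + 1 := by positivity
  have h1 : mollify (kernel E n) w x = ∫ z, kernel E n z * w (x + z) := by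
    rw [mollify, ← integral_add_left_eq_self (fun y => kernel E n (x - y) * w y) x]
    simp [kernel_neg]
  rw [h1]
  have h2 := Measure.integral_comp_smul (volume : Measure E)
    (fun z => kernel E 0 z * w (x + ((n : ℝ) + 1)⁻¹ • z)) ((n : ℝ) + 1)
  simp only [kernel_scaling n, mul_assoc, integral_const_mul]
  simp only [smul_smul, inv_mul_cancel₀ h0.ne', one_smul] at h2
  rw [h2, abs_of_pos (by positivity), smul_eq_mul, mul_inv_cancel_left₀ (by positivity)]

theorem ae_tendsto_mollify_kernel {g : E → ℝ} (hg : LocallyIntegrable g) :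
    ∀ᵐ x, Tendsto (fun n => mollify (kernel E n) g x) atTop (𝓝 (g x)) := by
  have h := ContDiffBump.ae_convolution_tendsto_right_of_locallyIntegrable (μ := (volume : Measure E))
    (φ := fun n => stdBump E n) (l := atTop) (K := 2) (g := g) ?_ ?_ hg
  · filter_upwards [h] with x hx
    convert hx using 2 with n
    simp [mollify, convolution_eq_swap, kernel]
  · simpa [stdBump] using tendsto_one_div_add_atTop_nhds_zero_nat (𝕜 := ℝ)
  · refine Eventually.of_forall fun n => ?_
    simp only [stdBump, mul_inv]
    linarith

/-- After rescaling, mollifying at `x` means integrating `z ↦ w (x + ℓ z)` against a fixed bounded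
profile supported in the unit ball, so `L¹` convergence of the rescalings passes to the limit. The
blow up `v` may be nonconstant, so the limit may depend on the profile. -/
theorem tendsto_mollify_kernel_of_blowUp {w v : E → ℝ} {x : E} (hw : Integrable w)
    (hv : IntegrableOn v (Metric.ball 0 1))
    (h : Tendsto (fun ℓ : ℝ => ∫⁻ z in Metric.ball (0 : E) 1, ‖w (x + ℓ • z) - v z‖ₑ)
      (𝓝[>] 0) (𝓝 0)) :
    Tendsto (fun n => mollify (kernel E n) w x) atTop
      (𝓝 (∫ z in Metric.ball (0 : E) 1, kernel E 0 z * v z)) := by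
  obtain ⟨C, hC0, hC⟩ := (kernel_isTest (E := E) 0).exists_bound
  have hcont := (kernel_isTest (E := E) 0).continuous
  have hsupp : ∀ z ∉ Metric.ball (0 : E) 1, kernel E 0 z = 0 := fun z hz => by
    have h1 : (stdBump E 0).rOut = 1 := by simp [stdBump]
    rw [← Function.notMem_support, kernel, (stdBump E 0).support_normed_eq, h1]
    exact hz
  have e1 : ∀ n, mollify (kernel E n) w x
      = ∫ z in Metric.ball (0 : E) 1, kernel E 0 z * w (x + ((n : ℝ) + 1)⁻¹ • z) := fun n => by
    rw [mollify_kernel, setIntegral_eq_integral_of_forall_compl_eq_zero]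
    intro z hz
    rw [hsupp z hz, zero_mul]
  simp only [e1]
  have hlim : Tendsto (fun n : ℕ => ((n : ℝ) + 1)⁻¹) atTop (𝓝[>] 0) := by
    refine tendsto_nhdsWithin_iff.2 ⟨?_, Eventually.of_forall fun n => ?_⟩
    · simpa using tendsto_one_div_add_atTop_nhds_zero_nat (𝕜 := ℝ)
    · simp only [mem_Ioi]; positivity
  have hint : ∀ n : ℕ, Integrable (fun z => w (x + ((n : ℝ) + 1)⁻¹ • z)) := fun n => by
    have := (hw.comp_add_left x).comp_smul (R := ((n : ℝ) + 1)⁻¹) (by positivity)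
    exact this
  refine tendsto_integral_of_L1 _ ?_ (Eventually.of_forall fun n => ?_) ?_
  · exact hcont.aestronglyMeasurable.mul hv.aestronglyMeasurable
  · exact ((hint n).bdd_mul hcont.aestronglyMeasurable (Eventually.of_forall hC)).integrableOn
  · have h2 := ENNReal.Tendsto.const_mul (a := ENNReal.ofReal C) (h.comp hlim)
      (Or.inr ENNReal.ofReal_ne_top)
    rw [mul_zero] at h2
    refine tendsto_of_tendsto_of_tendsto_of_le_of_le tendsto_const_nhds h2 (fun n => zero_le)
      fun n => ?_
    simp only [Function.comp]
    rw [← lintegral_const_mul' _ _ ENNReal.ofReal_ne_top]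
    refine lintegral_mono fun z => ?_
    rw [← mul_sub, enorm_mul]
    gcongr
    rw [← ofReal_norm]
    exact ENNReal.ofReal_le_ofReal (hC z)

end Kernel

/-! ### Integration against components of a matrix valued measure. -/

section VectorMeasure

theorem enorm_le_sum_enorm {ι : Type*} [Fintype ι] (x : EuclideanSpace ℝ ι) :
    ‖x‖ₑ ≤ ∑ i, ‖x i‖ₑ := by
  classical
  calc ‖x‖ₑ = ‖∑ i, EuclideanSpace.single i (x i)‖ₑ := by
        congr 1
        ext j
        simp [Finset.sum_apply]
    _ ≤ ∑ i, ‖EuclideanSpace.single i (x i)‖ₑ := enorm_sum_le _ _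
    _ = ∑ i, ‖x i‖ₑ := by
        refine Finset.sum_congr rfl fun i _ => ?_
        rw [← ofReal_norm, PiLp.norm_single, ofReal_norm]

/-- The variation is dominated by the sum of the total variations of the coordinates, which are
signed measures and hence finite. Constants can then serve as dominating functions. -/
theorem isFiniteMeasure_variation {X ι : Type*} [MeasurableSpace X] [Fintype ι]
    (μ : VectorMeasure X (EuclideanSpace ℝ ι)) : IsFiniteMeasure μ.variation := by
  let ν : ι → SignedMeasure X := fun i =>
    μ.mapRange (EuclideanSpace.proj (𝕜 := ℝ) i : EuclideanSpace ℝ ι →L[ℝ] ℝ).toLinearMap.toAddMonoidHom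
      (EuclideanSpace.proj (𝕜 := ℝ) i).continuous
  have h : μ.variation ≤ ∑ i, (ν i).totalVariation := by
    refine VectorMeasure.variation_le_of_forall_enorm_le fun s hs => ?_
    rw [Measure.finsetSum_apply]
    exact (enorm_le_sum_enorm _).trans
      (Finset.sum_le_sum fun i _ => (ν i).enorm_le_totalVariation s)
  exact isFiniteMeasure_of_le _ h

variable {d : ℕ}

/-- The integral of `f` against the component `μ i j`. -/
noncomputable def componentIntegral (μ : VectorMeasure (Space d) (Mat d)) (i j : Fin d)
    (f : Space d → ℝ) : ℝ := (∫ᵛ x, f x ∂•μ) (i, j)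

variable {μ : VectorMeasure (Space d) (Mat d)} {i j : Fin d}

theorem enorm_componentIntegral_le {f : Space d → ℝ} {O : Set (Space d)} (hO : MeasurableSet O)
    (hfO : ∀ x ∉ O, f x = 0) {C : ℝ} (hC : ∀ᵐ x ∂μ.variation, x ∈ O → |f x| ≤ C) :
    ‖componentIntegral μ i j f‖ₑ ≤ ENNReal.ofReal C * μ.variation O := by
  have h1 : ‖componentIntegral μ i j f‖ₑ ≤ ‖∫ᵛ x, f x ∂•μ‖ₑ := by
    rw [enorm_le_iff_norm_le]
    exact PiLp.norm_apply_le _ _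
  refine h1.trans (VectorMeasure.enorm_integral_le_lintegral_enorm.trans ?_)
  have h2 : ‖(ContinuousLinearMap.lsmul ℝ ℝ : ℝ →L[ℝ] Mat d →L[ℝ] Mat d)‖ₑ ≤ 1 := by
    rw [← ofReal_norm, ENNReal.ofReal_le_one]
    exact ContinuousLinearMap.opNorm_lsmul_le
  calc _ ≤ 1 * ∫⁻ x, ‖f x‖ₑ ∂μ.variation := by gcongr
    _ ≤ 1 * ∫⁻ x, O.indicator (fun _ => ENNReal.ofReal C) x ∂μ.variation := by
        gcongr 1
        refine lintegral_mono_ae (hC.mono fun x hx => ?_)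
        by_cases h : x ∈ O
        · rw [indicator_of_mem h, ← ofReal_norm]
          exact ENNReal.ofReal_le_ofReal (hx h)
        · simp [h, hfO x h]
    _ = _ := by rw [one_mul, lintegral_indicator_const hO]

theorem tendsto_componentIntegral {F : ℕ → Space d → ℝ} {f : Space d → ℝ}
    (hm : ∀ n, AEStronglyMeasurable (F n) μ.variation) {C : ℝ}
    (hC : ∀ n, ∀ᵐ x ∂μ.variation, |F n x| ≤ C)
    (hl : ∀ᵐ x ∂μ.variation, Tendsto (fun n => F n x) atTop (𝓝 (f x))) :
    Tendsto (fun n => componentIntegral μ i j (F n)) atTop (𝓝 (componentIntegral μ i j f)) := by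
  have := isFiniteMeasure_variation μ
  have h := VectorMeasure.tendsto_integral_of_dominated_convergence (μ := μ)
    (B := ContinuousLinearMap.lsmul ℝ ℝ) (fun _ => C) hm (integrable_const C) hC hl
  exact ((EuclideanSpace.proj (𝕜 := ℝ) (i, j)).continuous.tendsto _).comp h

theorem componentIntegral_const_mul (c : ℝ) (f : Space d → ℝ) :
    componentIntegral μ i j (fun x => c * f x) = c * componentIntegral μ i j f := by
  have := VectorMeasure.integral_fun_smul μ (ContinuousLinearMap.lsmul ℝ ℝ) c f
  simp only [smul_eq_mul] at this
  simp [componentIntegral, this]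

end VectorMeasure

theorem tendsto_integral_mul_of_bounded {X : Type*} [MeasurableSpace X] {ν : Measure X}
    {f h : X → ℝ} {g : ℕ → X → ℝ} (hf : Integrable f ν)
    (hm : ∀ n, AEStronglyMeasurable (g n) ν) {C : ℝ} (hC : ∀ n x, |g n x| ≤ C)
    (hl : ∀ᵐ x ∂ν, Tendsto (fun n => g n x) atTop (𝓝 (h x))) :
    Tendsto (fun n => ∫ x, f x * g n x ∂ν) atTop (𝓝 (∫ x, f x * h x ∂ν)) := by
  refine tendsto_integral_of_dominated_convergence (fun x => |f x| * C)
    (fun n => hf.aestronglyMeasurable.mul (hm n)) (hf.abs.mul_const C)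
    (fun n => Eventually.of_forall fun x => ?_) (hl.mono fun x hx => hx.const_mul _)
  rw [Real.norm_eq_abs, abs_mul]
  exact mul_le_mul_of_nonneg_left (hC n x) (abs_nonneg _)

/-! ### Uniform bounds and pointwise limits of the standard mollifications. -/

section Pointwise

variable {E : Type*} [NormedAddCommGroup E] [NormedSpace ℝ E] [HasContDiffBump E]
  [MeasureSpace E] [BorelSpace E] [FiniteDimensional ℝ E] [(volume : Measure E).IsAddHaarMeasure]
  {O : Set E} {ψ g : E → ℝ} {C : ℝ}

theorem abs_mollify_kernel_le (hgC : ∀ x, |g x| ≤ C) (n : ℕ) (x : E) :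
    |mollify (kernel E n) g x| ≤ C := by
  simpa [integral_abs_kernel] using abs_mollify_le (kernel_isTest n).integrable hgC x

theorem abs_symMollify_kernel_le {A : ℝ} (hgC : ∀ x, |g x| ≤ C) (hψA : ∀ x, |ψ x| ≤ A) (n : ℕ)
    (x : E) : |symMollify (kernel E n) ψ g x| ≤ 2 * (A * C) := by
  simpa [integral_abs_kernel] using abs_symMollify_le (kernel_isTest n).integrable hgC hψA x

theorem tendsto_kernel_radius : Tendsto (fun n : ℕ => ((n : ℝ) + 1)⁻¹) atTop (𝓝 0) := by
  simpa using tendsto_one_div_add_atTop_nhds_zero_nat (𝕜 := ℝ)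

/-- The commutator vanishes in the limit by continuity of `ψ` alone, so convergence of the
mollifications is needed only where `ψ x ≠ 0`. This serves both Lebesgue and `|μ|`-almost every
point. -/
theorem tendsto_symMollify_kernel (hψ : IsTest O ψ) (hg : Integrable g) (hgC : ∀ x, |g x| ≤ C)
    {x : E} {V : ℝ}
    (hV : ψ x ≠ 0 → Tendsto (fun n => mollify (kernel E n) g x) atTop (𝓝 V)) :
    Tendsto (fun n => symMollify (kernel E n) ψ g x) atTop (𝓝 (2 * (ψ x * V))) := by
  have hC0 : 0 ≤ C := (abs_nonneg _).trans (hgC 0)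
  have h1 : Tendsto (fun n => symMollify (kernel E n) ψ g x
      - 2 * (ψ x * mollify (kernel E n) g x)) atTop (𝓝 0) := by
    refine Metric.tendsto_atTop.2 fun ε hε => ?_
    -- Dividing by `C + 1` rather than `C` covers `C = 0` and makes the final inequality strict.
    obtain ⟨δ, hδ, h⟩ := Metric.continuous_iff.1 hψ.continuous x (ε / (C + 1)) (by positivity)
    obtain ⟨N, hN⟩ := eventually_atTop.1 ((tendsto_kernel_radius).eventually_lt_const hδ)
    refine ⟨N, fun n hn => ?_⟩
    have := abs_symMollify_sub_le (kernel_isTest n) hg hgC hψ x (w := ε / (C + 1)) fun y hy =>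
      (h y (by rw [dist_comm]; exact hy.trans_lt (hN n hn))).le
    rw [dist_zero_right, Real.norm_eq_abs]
    refine this.trans_lt ?_
    rw [integral_abs_kernel, mul_one, div_mul_eq_mul_div, div_lt_iff₀ (by positivity)]
    nlinarith
  have h2 : Tendsto (fun n => 2 * (ψ x * mollify (kernel E n) g x)) atTop
      (𝓝 (2 * (ψ x * V))) := by
    by_cases h : ψ x = 0
    · simp [h]
    · exact ((hV h).const_mul _).const_mul _
  simpa using h1.add h2

end Pointwise

/-! ### The advection term of a single time slice. -/

section FixedTime

variable {d : ℕ} {O : Set (Space d)} {w : Fin d → Space d → ℝ} {C : ℝ}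
  {μ : VectorMeasure (Space d) (Mat d)}

/-- The integrand of `∫ ½ |w|² div Ψ - (w ⊗ w) : ∇ Ψ`. -/
noncomputable def advectionDensity (w Ψ : Fin d → Space d → ℝ) (x : Space d) : ℝ :=
  ∑ i, ∑ j, (w j x * w j x * dirDeriv (e i) (Ψ i) x / 2 - w i x * w j x * dirDeriv (e j) (Ψ i) x)

/-- A bounded integrable divergence free field on `O` with antisymmetric gradient `μ`. -/
structure IsSlice (O : Set (Space d)) (C : ℝ) (w : Fin d → Space d → ℝ)
    (μ : VectorMeasure (Space d) (Mat d)) : Prop where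
  integrable : ∀ i, Integrable (w i)
  bound : ∀ i x, |w i x| ≤ C
  div : ∀ ζ, IsTest O ζ → ∑ j, ∫ x, w j x * dirDeriv (e j) ζ x = 0
  curl : ∀ i j ζ, IsTest O ζ →
    (∫ x, w j x * dirDeriv (e i) ζ x) - ∫ x, w i x * dirDeriv (e j) ζ x = componentIntegral μ i j ζ
  blowUp : ∀ᵐ x ∂μ.variation, x ∈ O → ∀ j,
    ∃ V, Tendsto (fun n => mollify (kernel (Space d) n) (w j) x) atTop (𝓝 V)

variable (w) in
/-- The limit of the mollifications of `w`. -/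
noncomputable def preciseValue (j : Fin d) (x : Space d) : ℝ :=
  limUnder atTop fun n => mollify (kernel (Space d) n) (w j) x

namespace IsSlice

theorem tendsto_preciseValue (h : IsSlice O C w μ) : ∀ᵐ x ∂μ.variation, x ∈ O → ∀ j,
    Tendsto (fun n => mollify (kernel (Space d) n) (w j) x) atTop (𝓝 (preciseValue w j x)) :=
  h.blowUp.mono fun _ hx hxO j => tendsto_nhds_limUnder (hx hxO j)

theorem abs_preciseValue_le (h : IsSlice O C w μ) : ∀ᵐ x ∂μ.variation, x ∈ O → ∀ j,
    |preciseValue w j x| ≤ C :=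
  h.tendsto_preciseValue.mono fun x hx hxO j =>
    le_of_tendsto (hx hxO j).abs (Eventually.of_forall fun n => abs_mollify_kernel_le (h.bound j) n x)

theorem componentIntegral_antisymm (h : IsSlice O C w μ) {ζ : Space d → ℝ} (hζ : IsTest O ζ)
    (i j : Fin d) : componentIntegral μ i j ζ = - componentIntegral μ j i ζ := by
  rw [← h.curl i j ζ hζ, ← h.curl j i ζ hζ]
  ring

theorem integrable_mul (h : IsSlice O C w μ) (i j : Fin d) :
    Integrable (fun x => w i x * w j x) :=
  (h.integrable i).mul_bdd (h.integrable j).aestronglyMeasurable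
    (Eventually.of_forall fun x => h.bound j x)

/-- The curl identity is tested with the mollification of `Ψ i * w j`. Evenness of the kernel
simplifies the term with `∂_i` and `w j`; zero divergence, after summing over `j`, the term with
`∂_j` and `w i`. No derivative of the kernel remains. -/
theorem sum_componentIntegral_symMollify (h : IsSlice O C w μ) {S : Set (Space d)}
    (hS : IsCompact S) {Ψ : Fin d → Space d → ℝ} (hΨ : ∀ i, IsTest S (Ψ i)) {n : ℕ}
    (hSO : Metric.cthickening ((n : ℝ) + 1)⁻¹ S ⊆ O) :
    ∑ i, ∑ j, componentIntegral μ i j (symMollify (kernel (Space d) n) (Ψ i) (w j))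
      = ∑ i, ∑ j, ((∫ x, dirDeriv (e i) (Ψ i) x * (w j x * mollify (kernel (Space d) n) (w j) x))
        - ∫ x, w i x * symMollify (kernel (Space d) n) (dirDeriv (e j) (Ψ i)) (w j) x) := by
  have hk := kernel_isTest (E := Space d) n
  have hcb : ∀ x ∈ S, Metric.closedBall x ((n : ℝ) + 1)⁻¹ ⊆ O := fun x hx =>
    (Metric.closedBall_subset_cthickening hx _).trans hSO
  have hT : ∀ i j, IsTest O (symMollify (kernel (Space d) n) (Ψ i) (w j)) := fun i j =>
    (hk.symMollify hS (hΨ i) (h.integrable j)).mono hSO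
  refine Finset.sum_congr rfl fun i _ => ?_
  have e1 : ∀ j, componentIntegral μ i j (symMollify (kernel (Space d) n) (Ψ i) (w j))
      = (∫ x, dirDeriv (e i) (Ψ i) x * (w j x * mollify (kernel (Space d) n) (w j) x))
        - ∫ x, w i x * dirDeriv (e j) (symMollify (kernel (Space d) n) (Ψ i) (w j)) x := fun j => by
    rw [← h.curl i j _ (hT i j), integral_mul_dirDeriv_symMollify hk (kernel_neg n)
      ((hΨ i).mono (subset_univ _)) (h.integrable j)]
  have hsub : S ⊆ O := (Metric.self_subset_cthickening S).trans hSO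
  have e2 := sum_dirDeriv_symMollify h.integrable e h.div hk (hΨ i) hsub hcb
  have hi1 : ∀ j, Integrable
      (fun x => w i x * dirDeriv (e j) (symMollify (kernel (Space d) n) (Ψ i) (w j)) x) := fun j => by
    simpa only [mul_comm] using ((hT i j).dirDeriv (e j)).integrable_mul (h.integrable i)
  have hi2 : ∀ j, Integrable
      (fun x => w i x * symMollify (kernel (Space d) n) (dirDeriv (e j) (Ψ i)) (w j) x) :=
    fun j => by
    simpa only [mul_comm] using (hk.symMollify hS ((hΨ i).dirDeriv (e j))
      (h.integrable j)).integrable_mul (h.integrable i)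
  simp only [e1, Finset.sum_sub_distrib]
  congr 1
  rw [← integral_finsetSum _ fun j _ => hi1 j, ← integral_finsetSum _ fun j _ => hi2 j]
  refine integral_congr_ae (Eventually.of_forall fun x => ?_)
  simp only [← Finset.mul_sum, e2]
  rfl

/-- The weak form of `div (w ⊗ w) - ∇ |w|² / 2 = μ w`, obtained as the limit of the mollified
identity: the side with `μ` converges by dominated convergence for the variation of `μ`, the other
for Lebesgue measure. Both limits carry the factor `2` produced by symmetrization. -/
theorem integral_advectionDensity (h : IsSlice O C w μ) (hO : IsOpen O) {S : Set (Space d)}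
    (hS : IsCompact S) (hSO : S ⊆ O) {Ψ : Fin d → Space d → ℝ} (hΨ : ∀ i, IsTest S (Ψ i)) :
    ∫ x, advectionDensity w Ψ x
      = ∑ i, ∑ j, componentIntegral μ i j (fun x => Ψ i x * preciseValue w j x) := by
  obtain ⟨δ, hδ, hδO⟩ := hS.exists_cthickening_subset_open hO hSO
  have hev : ∀ᶠ n : ℕ in atTop, Metric.cthickening ((n : ℝ) + 1)⁻¹ S ⊆ O :=
    ((tendsto_kernel_radius).eventually_lt_const hδ).mono fun n hn =>
      (Metric.cthickening_mono hn.le S).trans hδO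
  have hl : Tendsto (fun n => ∑ i, ∑ j,
      componentIntegral μ i j (symMollify (kernel (Space d) n) (Ψ i) (w j))) atTop
      (𝓝 (∑ i, ∑ j, 2 * componentIntegral μ i j (fun x => Ψ i x * preciseValue w j x))) := by
    refine tendsto_finsetSum _ fun i _ => tendsto_finsetSum _ fun j _ => ?_
    rw [← componentIntegral_const_mul]
    obtain ⟨A, -, hA⟩ := (hΨ i).exists_bound
    refine tendsto_componentIntegral (C := 2 * (A * C)) (fun n => ?_)
      (fun n => Eventually.of_forall fun x => abs_symMollify_kernel_le (h.bound j) hA n x) ?_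
    · exact ((kernel_isTest n).symMollify hS (hΨ i)
        (h.integrable j)).continuous.aestronglyMeasurable
    · filter_upwards [h.tendsto_preciseValue] with x hx
      refine tendsto_symMollify_kernel (hΨ i) (h.integrable j) (h.bound j) fun h0 => ?_
      exact hx (hSO (by_contra fun hxS => h0 ((hΨ i).eq_zero hxS))) j
  have hr : Tendsto (fun n => ∑ i, ∑ j,
      ((∫ x, dirDeriv (e i) (Ψ i) x * (w j x * mollify (kernel (Space d) n) (w j) x))
        - ∫ x, w i x * symMollify (kernel (Space d) n) (dirDeriv (e j) (Ψ i)) (w j) x)) atTop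
      (𝓝 (∑ i, ∑ j, ((∫ x, dirDeriv (e i) (Ψ i) x * (w j x * w j x))
        - ∫ x, w i x * (2 * (dirDeriv (e j) (Ψ i) x * w j x))))) := by
    refine tendsto_finsetSum _ fun i _ => tendsto_finsetSum _ fun j _ => ?_
    have hae := ae_tendsto_mollify_kernel (h.integrable j).locallyIntegrable
    refine Tendsto.sub ?_ ?_
    · simp only [← mul_assoc]
      refine tendsto_integral_mul_of_bounded
        (((hΨ i).dirDeriv (e i)).integrable_mul (h.integrable j))
        (fun n => ((kernel_isTest n).contDiff_mollify
          (h.integrable j)).continuous.aestronglyMeasurable)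
        (fun n x => abs_mollify_kernel_le (h.bound j) n x) hae
    · obtain ⟨A, -, hA⟩ := ((hΨ i).dirDeriv (e j)).exists_bound
      refine tendsto_integral_mul_of_bounded (h.integrable i)
        (fun n => ((kernel_isTest n).symMollify hS ((hΨ i).dirDeriv (e j))
          (h.integrable j)).continuous.aestronglyMeasurable)
        (fun n x => abs_symMollify_kernel_le (h.bound j) hA n x) (hae.mono fun x hx => ?_)
      exact tendsto_symMollify_kernel ((hΨ i).dirDeriv (e j)) (h.integrable j) (h.bound j)
        fun _ => hx
  have heq := tendsto_nhds_unique (hl.congr' (hev.mono fun n hn =>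
    h.sum_componentIntegral_symMollify hS hΨ hn)) hr
  simp only [← Finset.mul_sum] at heq
  have hi1 : ∀ i j, Integrable (fun x => dirDeriv (e i) (Ψ i) x * (w j x * w j x)) := fun i j =>
    ((hΨ i).dirDeriv (e i)).integrable_mul (h.integrable_mul j j)
  have hi2 : ∀ i j, Integrable (fun x => w i x * (2 * (dirDeriv (e j) (Ψ i) x * w j x))) :=
    fun i j => ((((hΨ i).dirDeriv (e j)).integrable_mul (h.integrable_mul i j)).const_mul 2).congr
      (Eventually.of_forall fun x => by ring)
  have e3 : ∫ x, advectionDensity w Ψ x = 1 / 2 * ∑ i, ∑ j,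
      ((∫ x, dirDeriv (e i) (Ψ i) x * (w j x * w j x))
        - ∫ x, w i x * (2 * (dirDeriv (e j) (Ψ i) x * w j x))) := by
    have e4 : ∀ i j, (∫ x, dirDeriv (e i) (Ψ i) x * (w j x * w j x))
        - ∫ x, w i x * (2 * (dirDeriv (e j) (Ψ i) x * w j x))
        = ∫ x, (dirDeriv (e i) (Ψ i) x * (w j x * w j x)
          - w i x * (2 * (dirDeriv (e j) (Ψ i) x * w j x))) := fun i j =>
      (integral_sub (hi1 i j) (hi2 i j)).symm
    have e5 : ∀ i, ∑ j, ∫ x, (dirDeriv (e i) (Ψ i) x * (w j x * w j x)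
          - w i x * (2 * (dirDeriv (e j) (Ψ i) x * w j x)))
        = ∫ x, ∑ j, (dirDeriv (e i) (Ψ i) x * (w j x * w j x)
          - w i x * (2 * (dirDeriv (e j) (Ψ i) x * w j x))) := fun i =>
      (integral_finsetSum _ fun j _ => (hi1 i j).sub (hi2 i j)).symm
    have hi3 : ∀ i j, Integrable (fun x => dirDeriv (e i) (Ψ i) x * (w j x * w j x)
          - w i x * (2 * (dirDeriv (e j) (Ψ i) x * w j x))) := fun i j => (hi1 i j).sub (hi2 i j)
    simp only [e4, e5]
    rw [← integral_finsetSum _ fun i _ => integrable_finsetSum _ fun j _ => hi3 i j,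
      ← integral_const_mul]
    refine integral_congr_ae (Eventually.of_forall fun x => ?_)
    simp only [advectionDensity, Finset.mul_sum]
    refine Finset.sum_congr rfl fun i _ => Finset.sum_congr rfl fun j _ => ?_
    ring
  rw [e3, ← heq]
  ring

/-- Only the supremum of `Ψ` enters, although the integrand contains its gradient. Applied to
mollified fields, this gives a bound uniform in the mollification scale. -/
theorem enorm_integral_advectionDensity_le (h : IsSlice O C w μ) (hO : IsOpen O)
    {S : Set (Space d)} (hS : IsCompact S) (hSO : S ⊆ O) {Ψ : Fin d → Space d → ℝ}
    (hΨ : ∀ i, IsTest S (Ψ i)) {A : ℝ} (hA : ∀ i x, |Ψ i x| ≤ A) :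
    ‖∫ x, advectionDensity w Ψ x‖ₑ
      ≤ (∑ _i : Fin d, ∑ _j : Fin d, ENNReal.ofReal (A * C)) * μ.variation O := by
  rw [h.integral_advectionDensity hO hS hSO hΨ]
  simp only [Finset.sum_mul]
  refine (enorm_sum_le _ _).trans (Finset.sum_le_sum fun i _ =>
    (enorm_sum_le _ _).trans (Finset.sum_le_sum fun j _ => ?_))
  refine enorm_componentIntegral_le hO.measurableSet (fun x hx => ?_) ?_
  · rw [(hΨ i).eq_zero fun h => hx (hSO h), zero_mul]
  · filter_upwards [h.abs_preciseValue_le] with x hx hxO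
    rw [abs_mul]
    exact mul_le_mul (hA i x) (hx hxO j) (abs_nonneg _) ((abs_nonneg _).trans (hA i x))

/-- The limit pairs the symmetric tensor `2 φ w̃ᵢ w̃ⱼ`, with `w̃` the precise value, with an
antisymmetric measure. Antisymmetry is available only against test functions, so the vanishing is
proved for a second, smooth approximation of the same limit. -/
theorem tendsto_integral_advectionDensity (h : IsSlice O C w μ) (hO : IsOpen O)
    {S : Set (Space d)} (hS : IsCompact S) (hSO : S ⊆ O) {φ : Space d → ℝ} (hφ : IsTest S φ) :
    Tendsto (fun n => ∫ x, advectionDensity w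
      (fun i => symMollify (kernel (Space d) n) φ (w i)) x) atTop (𝓝 0) := by
  obtain ⟨δ, hδ, hδO⟩ := hS.exists_cthickening_subset_open hO hSO
  have hev : ∀ᶠ n : ℕ in atTop, Metric.cthickening ((n : ℝ) + 1)⁻¹ S ⊆ O :=
    ((tendsto_kernel_radius).eventually_lt_const hδ).mono fun n hn =>
      (Metric.cthickening_mono hn.le S).trans hδO
  obtain ⟨A, hA0, hA⟩ := hφ.exists_bound
  have hT : ∀ (n : ℕ) j, IsTest (Metric.cthickening ((n : ℝ) + 1)⁻¹ S)
      (symMollify (kernel (Space d) n) φ (w j)) := fun n j =>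
    (kernel_isTest n).symMollify hS hφ (h.integrable j)
  have hz : ∀ x, x ∉ O → φ x = 0 := fun x hx => hφ.eq_zero fun h => hx (hSO h)
  have hcm : ∀ n j, ContDiff ℝ ∞ (mollify (kernel (Space d) n) (w j)) := fun n j =>
    (kernel_isTest n).contDiff_mollify (h.integrable j)
  have hC0 : 0 ≤ |C| := abs_nonneg C
  have hbd : ∀ n j x, |mollify (kernel (Space d) n) (w j) x| ≤ |C| := fun n j x =>
    (abs_mollify_kernel_le (h.bound j) n x).trans (le_abs_self C)
  have hsym : ∀ n j x, |symMollify (kernel (Space d) n) φ (w j) x| ≤ 2 * (A * |C|) := fun n j x =>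
    abs_symMollify_kernel_le (fun y => (h.bound j y).trans (le_abs_self C)) hA n x
  -- the products with the precise value are measurable and bounded where they are supported
  have hmeas : ∀ n : ℕ, Metric.cthickening ((n : ℝ) + 1)⁻¹ S ⊆ O → ∀ i j, AEStronglyMeasurable
      (fun x => symMollify (kernel (Space d) n) φ (w i) x * preciseValue w j x) μ.variation := by
    intro n hn i j
    refine aestronglyMeasurable_of_tendsto_ae atTop
      (f := fun m x => symMollify (kernel (Space d) n) φ (w i) x
        * mollify (kernel (Space d) m) (w j) x)
      (fun m => ((hT n i).continuous.mul (hcm m j).continuous).aestronglyMeasurable) ?_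
    filter_upwards [h.tendsto_preciseValue] with x hx
    by_cases hxO : x ∈ O
    · exact (hx hxO j).const_mul _
    · simp [(hT n i).eq_zero fun h => hxO (hn h)]
  have hlim : Tendsto (fun n => ∑ i, ∑ j, componentIntegral μ i j
      (fun x => symMollify (kernel (Space d) n) φ (w i) x * preciseValue w j x)) atTop
      (𝓝 (∑ i, ∑ j, componentIntegral μ i j
        (fun x => 2 * (φ x * preciseValue w i x) * preciseValue w j x))) := by
    obtain ⟨N, hN⟩ := eventually_atTop.1 hev
    -- Starting at `N` keeps every support inside `O`; outside `O` nothing is known about the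
    -- precise value.
    rw [← tendsto_add_atTop_iff_nat N]
    refine tendsto_finsetSum _ fun i _ => tendsto_finsetSum _ fun j _ => ?_
    refine tendsto_componentIntegral (C := 2 * (A * |C|) * |C|)
      (fun n => hmeas _ (hN _ (Nat.le_add_left _ _)) i j) (fun n => ?_) ?_
    · filter_upwards [h.abs_preciseValue_le] with x hx
      by_cases hxO : x ∈ O
      · rw [abs_mul]
        exact mul_le_mul (hsym _ i x) ((hx hxO j).trans (le_abs_self C)) (abs_nonneg _)
          (by positivity)
      · rw [(hT _ i).eq_zero fun h => hxO (hN _ (Nat.le_add_left _ _) h), zero_mul, abs_zero]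
        positivity
    · filter_upwards [h.tendsto_preciseValue] with x hx
      refine Tendsto.mul_const _ ?_
      refine (tendsto_add_atTop_iff_nat
        (f := fun n => symMollify (kernel (Space d) n) φ (w i) x) N).2 ?_
      exact tendsto_symMollify_kernel hφ (h.integrable i) (h.bound i) fun h0 =>
        hx (by_contra fun hxO => h0 (hz x hxO)) i
  -- Mollifying both factors at the same scale gives test functions symmetric in `i` and `j`, with
  -- the limit found in `hlim`.
  have hlim2 : Tendsto (fun m => ∑ i, ∑ j, componentIntegral μ i j
      (fun x => 2 * (φ x * mollify (kernel (Space d) m) (w i) x)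
        * mollify (kernel (Space d) m) (w j) x)) atTop
      (𝓝 (∑ i, ∑ j, componentIntegral μ i j
        (fun x => 2 * (φ x * preciseValue w i x) * preciseValue w j x))) := by
    refine tendsto_finsetSum _ fun i _ => tendsto_finsetSum _ fun j _ => ?_
    refine tendsto_componentIntegral (C := 2 * (A * |C|) * |C|) (fun m => ?_) (fun m => ?_) ?_
    · exact ((continuous_const.mul (hφ.continuous.mul (hcm m i).continuous)).mul
        (hcm m j).continuous).aestronglyMeasurable
    · refine Eventually.of_forall fun x => ?_
      rw [abs_mul, abs_mul, abs_mul, abs_two]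
      exact mul_le_mul (mul_le_mul_of_nonneg_left (mul_le_mul (hA x) (hbd m i x) (abs_nonneg _) hA0)
        zero_le_two) (hbd m j x) (abs_nonneg _) (by positivity)
    · filter_upwards [h.tendsto_preciseValue] with x hx
      by_cases hxO : x ∈ O
      · exact (((hx hxO i).const_mul _).const_mul _).mul (hx hxO j)
      · simp [hz x hxO]
  have hzero : ∀ m, ∑ i, ∑ j, componentIntegral μ i j
      (fun x => 2 * (φ x * mollify (kernel (Space d) m) (w i) x)
        * mollify (kernel (Space d) m) (w j) x) = 0 := by
    intro m
    have hsum : ∑ i, ∑ j, componentIntegral μ i j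
        (fun x => 2 * (φ x * mollify (kernel (Space d) m) (w i) x)
          * mollify (kernel (Space d) m) (w j) x) = - ∑ i, ∑ j, componentIntegral μ i j
        (fun x => 2 * (φ x * mollify (kernel (Space d) m) (w i) x)
          * mollify (kernel (Space d) m) (w j) x) := by
      conv_rhs => rw [Finset.sum_comm]
      simp only [← Finset.sum_neg_distrib]
      refine Finset.sum_congr rfl fun i _ => Finset.sum_congr rfl fun j _ => ?_
      have ht : IsTest O (fun x => 2 * (φ x * mollify (kernel (Space d) m) (w i) x)
          * mollify (kernel (Space d) m) (w j) x) :=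
        (((hφ.mul_right (hcm m i)).mul_left contDiff_const).mul_right (hcm m j)).mono hSO
      rw [h.componentIntegral_antisymm ht]
      congr 2
      ext x
      ring
    linarith
  have hlim3 := tendsto_nhds_unique hlim2 (by simp only [hzero]; exact tendsto_const_nhds)
  rw [hlim3] at hlim
  refine hlim.congr' (hev.mono fun n hn => ?_)
  exact (h.integral_advectionDensity hO hS.cthickening hn (hT n)).symm

end IsSlice

end FixedTime

/-! ### Tensor product kernels in space-time and time slices. -/

section Tensor

/-- The restriction of `g` to the time slice at `t`. -/
def slice {E : Type*} (g : ℝ × E → ℝ) (t : ℝ) : E → ℝ := fun y => g (t, y)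

/-- The tensor product of a function of time and a function of space. -/
def tensor {E : Type*} (χ : ℝ → ℝ) (k : E → ℝ) : ℝ × E → ℝ := fun z => χ z.1 * k z.2

variable {E : Type*} [NormedAddCommGroup E] [NormedSpace ℝ E]
  {χ : ℝ → ℝ} {k : E → ℝ} {φ g : ℝ × E → ℝ}

theorem dirDeriv_slice (hφ : Differentiable ℝ φ) (v : E) (t : ℝ) (x : E) :
    dirDeriv v (slice φ t) x = dirDeriv (0, v) φ (t, x) := by
  have h : HasFDerivAt (slice φ t) ((fderiv ℝ φ (t, x)).comp (ContinuousLinearMap.inr ℝ ℝ E)) x :=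
    (hφ (t, x)).hasFDerivAt.comp x (hasFDerivAt_prodMk_right t x)
  simp [dirDeriv, h.fderiv]

theorem IsTest.slice {O : Set (ℝ × E)} (hφ : IsTest O φ) (t : ℝ) :
    IsTest (Prod.snd '' O) (slice φ t) := by
  have hc : IsCompact (Prod.snd '' tsupport φ) := hφ.compact.image continuous_snd
  have hs : tsupport (EulerEnergy.slice φ t) ⊆ Prod.snd '' tsupport φ :=
    closure_minimal (fun y hy => ⟨(t, y), subset_tsupport φ hy, rfl⟩) hc.isClosed
  exact ⟨hφ.smooth.comp (contDiff_const.prodMk contDiff_id),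
    hc.of_isClosed_subset (isClosed_tsupport _) hs, hs.trans (image_mono hφ.subset)⟩

theorem dirDeriv_tensor (hχ : Differentiable ℝ χ) (hk : Differentiable ℝ k) (v : E) :
    dirDeriv (0, v) (tensor χ k) = tensor χ (dirDeriv v k) := by
  ext z
  have hd : Differentiable ℝ (tensor χ k) :=
    (hχ.comp differentiable_fst).mul (hk.comp differentiable_snd)
  have h := dirDeriv_slice hd v z.1 z.2
  rw [Prod.mk.eta] at h
  rw [← h]
  have : EulerEnergy.slice (tensor χ k) z.1 = fun y => χ z.1 * k y := rfl
  rw [this, dirDeriv, fderiv_const_mul (hk _)]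
  simp [tensor, dirDeriv]

theorem IsTest.tensor {A : Set ℝ} {B : Set E} (hχ : IsTest A χ) (hk : IsTest B k) :
    IsTest (A ×ˢ B) (tensor χ k) := by
  have hc : IsCompact (tsupport χ ×ˢ tsupport k) := hχ.compact.prod hk.compact
  have hs : tsupport (EulerEnergy.tensor χ k) ⊆ tsupport χ ×ˢ tsupport k := by
    refine closure_minimal (fun z hz => ⟨subset_tsupport _ ?_, subset_tsupport _ ?_⟩) hc.isClosed
    · exact left_ne_zero_of_mul hz
    · exact right_ne_zero_of_mul hz
  exact ⟨(hχ.smooth.comp contDiff_fst).mul (hk.smooth.comp contDiff_snd),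
    hc.of_isClosed_subset (isClosed_tsupport _) hs, hs.trans (prod_mono hχ.subset hk.subset)⟩

variable [MeasureSpace E] [BorelSpace E] [FiniteDimensional ℝ E]
  [(volume : Measure E).IsAddHaarMeasure] {O : Set E}

instance : (volume : Measure (ℝ × E)).IsAddHaarMeasure :=
  Measure.prod.instIsAddHaarMeasure volume volume

theorem integral_abs_tensor (χ : ℝ → ℝ) (k : E → ℝ) :
    ∫ z, |tensor χ k z| = (∫ s, |χ s|) * ∫ y, |k y| := by
  simp only [tensor, abs_mul]
  exact integral_prod_mul (fun s => |χ s|) fun y => |k y|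

theorem mollify_tensor {A : Set ℝ} (hχ : IsTest A χ) (hk : IsTest O k) (hg : Integrable g)
    (z : ℝ × E) :
    mollify (tensor χ k) g z = mollify χ (fun s => mollify k (slice g s) z.2) z.1 := by
  have hint := (hχ.tensor hk).integrable_mollify hg z
  simp only [mollify]
  rw [Measure.volume_eq_prod, integral_prod _ hint]
  refine integral_congr_ae (Eventually.of_forall fun s => ?_)
  simp only [tensor, Prod.fst_sub, Prod.snd_sub, slice]
  rw [← integral_const_mul]
  refine integral_congr_ae (Eventually.of_forall fun y => ?_)
  simp only
  ring

theorem stronglyMeasurable_mollify_slice (hk : Continuous k) (hg : StronglyMeasurable g) :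
    StronglyMeasurable (fun z : ℝ × E => mollify k (slice g z.1) z.2) := by
  have h : StronglyMeasurable (fun q : (ℝ × E) × E => k (q.1.2 - q.2) * g (q.1.1, q.2)) := by
    refine (hk.comp ?_).stronglyMeasurable.mul (hg.comp_measurable ?_)
    · fun_prop
    · fun_prop
  exact h.integral_prod_right'

theorem stronglyMeasurable_symMollify_slice (hk : Continuous k) (hφ : Continuous φ)
    (hg : StronglyMeasurable g) :
    StronglyMeasurable (fun z : ℝ × E => symMollify k (slice φ z.1) (slice g z.1) z.2) :=
  (hφ.stronglyMeasurable.mul (stronglyMeasurable_mollify_slice hk hg)).add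
    (stronglyMeasurable_mollify_slice hk (hφ.stronglyMeasurable.mul hg))

theorem integrable_mollify_slice (hk : IsTest O k) (hg : Integrable g) (x : E) :
    Integrable (fun t => mollify k (slice g t) x) := by
  obtain ⟨C, -, hC⟩ := hk.exists_bound
  have h : Integrable (fun z : ℝ × E => k (x - z.2) * g z) ((volume : Measure ℝ).prod volume) :=
    hg.bdd_mul (hk.continuous.comp (by fun_prop)).aestronglyMeasurable
      (Eventually.of_forall fun z => hC _)
  exact h.integral_prod_left

/-- For each fixed `x` this is Lebesgue differentiation in time of the integrable function `t ↦
mollify k (slice g t) x`. Measurability of the convergence set lets Fubini exchange the order of the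
almost everywhere quantifiers. -/
theorem ae_tendsto_mollify_tensor (hk : IsTest O k) (hg : Integrable g)
    (hgm : StronglyMeasurable g) :
    ∀ᵐ z : ℝ × E, Tendsto (fun m => mollify (tensor (kernel ℝ m) k) g z) atTop
      (𝓝 (mollify k (slice g z.1) z.2)) := by
  have hm := stronglyMeasurable_mollify_slice hk.continuous hgm
  rw [Measure.volume_eq_prod]
  refine (Measure.ae_prod_iff_ae_ae ?_).2 ?_
  · refine measurableSet_tendsto_fun (fun m => ?_) hm.measurable
    exact (((kernel_isTest m).tensor hk).contDiff_mollify hg).continuous.measurable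
  · have : ∀ x : E, ∀ᵐ t : ℝ, Tendsto (fun m => mollify (tensor (kernel ℝ m) k) g (t, x)) atTop
        (𝓝 (mollify k (slice g t) x)) := by
      intro x
      have hi := integrable_mollify_slice hk hg x
      filter_upwards [ae_tendsto_mollify_kernel hi.locallyIntegrable] with t ht
      simpa only [mollify_tensor (kernel_isTest _) hk hg] using ht
    refine (Measure.ae_ae_comm ?_).1 (Eventually.of_forall this)
    refine measurableSet_tendsto_fun (fun m => ?_) ?_
    · exact ((((kernel_isTest m).tensor hk).contDiff_mollify hg).continuous.measurable).comp
        measurable_swap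
    · exact hm.measurable.comp measurable_swap

theorem ae_tendsto_mollify_slice [HasContDiffBump E] (hgm : StronglyMeasurable g)
    (hgi : ∀ t, Integrable (slice g t)) :
    ∀ᵐ z : ℝ × E, Tendsto (fun n => mollify (kernel E n) (slice g z.1) z.2) atTop (𝓝 (g z)) := by
  rw [Measure.volume_eq_prod]
  refine (Measure.ae_prod_iff_ae_ae ?_).2 (Eventually.of_forall fun t =>
    ae_tendsto_mollify_kernel (hgi t).locallyIntegrable)
  exact measurableSet_tendsto_fun (fun n => (stronglyMeasurable_mollify_slice
    (kernel_isTest n).continuous hgm).measurable) hgm.measurable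

end Tensor

/-! ### Testing the momentum equation and removing the mollification in time. -/

section SpaceTime

variable {d : ℕ}

/-- The open cylinder with base `O` and time interval `(0, T)`. -/
abbrev box (O : Set (Space d)) (T : ℝ) : Set (ℝ × Space d) := Ioo 0 T ×ˢ O

/-- A bounded weak solution on the cylinder with bounded base `O`, extended by zero. -/
structure IsLocalSolution (O : Set (Space d)) (T C : ℝ) (U : Fin d → ℝ × Space d → ℝ)
    (P : ℝ × Space d → ℝ) (F : Fin d → ℝ × Space d → ℝ) : Prop where
  measurable : ∀ i, StronglyMeasurable (U i)
  integrable : ∀ i, Integrable (U i)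
  integrable_slice : ∀ i t, Integrable (slice (U i) t)
  bound : ∀ i z, |U i z| ≤ C
  eq_zero : ∀ i, ∀ z ∉ box O T, U i z = 0
  integrable_pressure : Integrable P
  integrable_force : ∀ i, Integrable (F i)
  momentum : ∀ i Ψ, IsTest (box O T) Ψ →
    (∫ z, U i z * dirDeriv (1, 0) Ψ z) + (∑ j, ∫ z, (U i z * U j z) * dirDeriv (0, e j) Ψ z)
      + (∫ z, P z * dirDeriv (0, e i) Ψ z) + ∫ z, F i z * Ψ z = 0
  div : ∀ Ψ, IsTest (box O T) Ψ → ∑ j, ∫ z, U j z * dirDeriv (0, e j) Ψ z = 0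

namespace IsLocalSolution

variable {O : Set (Space d)} {T C : ℝ} {U : Fin d → ℝ × Space d → ℝ}
  {P : ℝ × Space d → ℝ} {F : Fin d → ℝ × Space d → ℝ} {φ : ℝ × Space d → ℝ}

theorem integrable_mul (h : IsLocalSolution O T C U P F) (i j : Fin d) :
    Integrable (fun z => U i z * U j z) :=
  (h.integrable i).mul_bdd (h.integrable j).aestronglyMeasurable
    (Eventually.of_forall fun x => h.bound j x)

/-- The test function is the symmetrized mollification of the solution; evenness of the tensor
kernel takes the time derivative off the kernel. -/
theorem energy_mollified_tensor (h : IsLocalSolution O T C U P F) (hφ : IsTest univ φ)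
    {m n : ℕ} (hmn : n ≤ m)
    (hO : Metric.cthickening ((n : ℝ) + 1)⁻¹ (tsupport φ) ⊆ box O T) :
    ∑ i, ((∫ z, (dirDeriv (1, 0) φ z * U i z)
          * mollify (tensor (kernel ℝ m) (kernel (Space d) n)) (U i) z)
      + (∑ j, ∫ z, (U i z * U j z) * dirDeriv (0, e j)
          (symMollify (tensor (kernel ℝ m) (kernel (Space d) n)) φ (U i)) z)
      + (∫ z, P z * dirDeriv (0, e i)
          (symMollify (tensor (kernel ℝ m) (kernel (Space d) n)) φ (U i)) z)
      + ∫ z, F i z * symMollify (tensor (kernel ℝ m) (kernel (Space d) n)) φ (U i) z) = 0 := by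
  have hk : IsTest (Metric.closedBall 0 ((n : ℝ) + 1)⁻¹)
      (tensor (kernel ℝ m) (kernel (Space d) n)) := by
    -- Products carry the maximum norm, so for `n ≤ m` the tensor kernel is supported in the ball of
    -- radius `1 / (n + 1)`, independently of `m`.
    refine ((kernel_isTest m).tensor (kernel_isTest n)).mono ?_
    have : Metric.closedBall (0 : ℝ) ((m : ℝ) + 1)⁻¹ ⊆ Metric.closedBall (0 : ℝ) ((n : ℝ) + 1)⁻¹ :=
      Metric.closedBall_subset_closedBall (by gcongr)
    exact (prod_mono_left this).trans (closedBall_prod_same _ _ _).subset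
  have he : ∀ z, tensor (kernel ℝ m) (kernel (Space d) n) (-z)
      = tensor (kernel ℝ m) (kernel (Space d) n) z := fun z => by
    simp [tensor, kernel_neg]
  have hφ' : IsTest (tsupport φ) φ := ⟨hφ.smooth, hφ.compact, subset_rfl⟩
  refine Finset.sum_eq_zero fun i _ => ?_
  have h1 := h.momentum i _ ((hk.symMollify hφ.compact hφ' (h.integrable i)).mono hO)
  rw [integral_mul_dirDeriv_symMollify hk he hφ (h.integrable i)] at h1
  simpa only [mul_assoc] using h1

/-- The spatial symmetrized mollification of `φ g`. -/
noncomputable def spaceMollify (n : ℕ) (φ g : ℝ × Space d → ℝ) (z : ℝ × Space d) : ℝ :=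
  symMollify (kernel (Space d) n) (slice φ z.1) (slice g z.1) z.2

/-- The limit `m → ∞` at fixed `n`. The time term contains no derivative of the kernel, and space
derivatives fall on `φ` or on the fixed space kernel, so every factor is bounded uniformly in `m`.
-/
theorem energy_mollified_slice (h : IsLocalSolution O T C U P F) (hφ : IsTest univ φ) {n : ℕ}
    (hO : Metric.cthickening ((n : ℝ) + 1)⁻¹ (tsupport φ) ⊆ box O T) :
    ∑ i, ((∫ z, (dirDeriv (1, 0) φ z * U i z)
          * mollify (kernel (Space d) n) (slice (U i) z.1) z.2)
      + (∑ j, ∫ z, (U i z * U j z) * dirDeriv (e j)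
          (symMollify (kernel (Space d) n) (slice φ z.1) (slice (U i) z.1)) z.2)
      + (∫ z, P z * dirDeriv (e i)
          (symMollify (kernel (Space d) n) (slice φ z.1) (slice (U i) z.1)) z.2)
      + ∫ z, F i z * spaceMollify n φ (U i) z) = 0 := by
  have hk := kernel_isTest (E := Space d) n
  obtain ⟨A, hA0, hA⟩ := hφ.exists_bound
  have hU := h.integrable
  have hφU : ∀ i, Integrable (fun z => φ z * U i z) := fun i => hφ.integrable_mul (hU i)
  have hφUm : ∀ i, StronglyMeasurable (fun z => φ z * U i z) := fun i =>
    hφ.continuous.stronglyMeasurable.mul (h.measurable i)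
  have hφUb : ∀ i z, |φ z * U i z| ≤ A * C := fun i z => by
    rw [abs_mul]
    exact mul_le_mul (hA z) (h.bound i z) (abs_nonneg _) hA0
  have hM : ∀ m : ℕ, IsTest (Metric.closedBall (0 : ℝ) ((m : ℝ) + 1)⁻¹ ×ˢ
      Metric.closedBall (0 : Space d) ((n : ℝ) + 1)⁻¹) (tensor (kernel ℝ m) (kernel (Space d) n)) :=
    fun m => (kernel_isTest m).tensor hk
  -- the mollifications converge almost everywhere and are bounded
  have hb : ∀ {k : Space d → ℝ} {g : ℝ × Space d → ℝ} {D : ℝ},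
      IsTest (Metric.closedBall (0 : Space d) ((n : ℝ) + 1)⁻¹) k → (∀ z, |g z| ≤ D) → ∀ m z,
      |mollify (tensor (kernel ℝ m) k) g z| ≤ D * ∫ y, |k y| := fun {k g D} hk' hg m z => by
    have := abs_mollify_le ((kernel_isTest m).tensor hk').integrable hg z
    rwa [integral_abs_tensor, integral_abs_kernel, one_mul] at this
  have hd : ∀ m i j z, dirDeriv (0, e j)
      (symMollify (tensor (kernel ℝ m) (kernel (Space d) n)) φ (U i)) z
      = dirDeriv (0, e j) φ z * mollify (tensor (kernel ℝ m) (kernel (Space d) n)) (U i) z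
      + (φ z * mollify (tensor (kernel ℝ m) (dirDeriv (e j) (kernel (Space d) n))) (U i) z
      + mollify (tensor (kernel ℝ m) (dirDeriv (e j) (kernel (Space d) n)))
        (fun y => φ y * U i y) z) := fun m i j z => by
    rw [dirDeriv_symMollify (hM m) hφ (hU i), dirDeriv_tensor (kernel_isTest m).differentiable
      hk.differentiable]
  have hds : ∀ i j (z : ℝ × Space d), dirDeriv (e j)
      (symMollify (kernel (Space d) n) (slice φ z.1) (slice (U i) z.1)) z.2
      = dirDeriv (0, e j) φ z * mollify (kernel (Space d) n) (slice (U i) z.1) z.2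
      + (φ z * mollify (dirDeriv (e j) (kernel (Space d) n)) (slice (U i) z.1) z.2
      + mollify (dirDeriv (e j) (kernel (Space d) n)) (slice (fun y => φ y * U i y) z.1) z.2) :=
    fun i j z => by
    rw [dirDeriv_symMollify hk ((hφ.slice z.1).mono (subset_univ _)) (h.integrable_slice i z.1),
      dirDeriv_slice hφ.differentiable]
    rfl
  have hlim1 : ∀ i, ∀ᵐ z : ℝ × Space d, Tendsto
      (fun m => mollify (tensor (kernel ℝ m) (kernel (Space d) n)) (U i) z) atTop
      (𝓝 (mollify (kernel (Space d) n) (slice (U i) z.1) z.2)) := fun i =>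
    ae_tendsto_mollify_tensor hk (hU i) (h.measurable i)
  have hlim2 : ∀ i, ∀ᵐ z : ℝ × Space d, Tendsto
      (fun m => symMollify (tensor (kernel ℝ m) (kernel (Space d) n)) φ (U i) z) atTop
      (𝓝 (spaceMollify n φ (U i) z)) := fun i => by
    filter_upwards [hlim1 i, ae_tendsto_mollify_tensor hk (hφU i) (hφUm i)] with z h1 h2
    exact (h1.const_mul _).add h2
  have hlim3 : ∀ i j, ∀ᵐ z : ℝ × Space d, Tendsto (fun m => dirDeriv (0, e j)
      (symMollify (tensor (kernel ℝ m) (kernel (Space d) n)) φ (U i)) z) atTop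
      (𝓝 (dirDeriv (e j)
        (symMollify (kernel (Space d) n) (slice φ z.1) (slice (U i) z.1)) z.2)) := fun i j => by
    filter_upwards [hlim1 i, ae_tendsto_mollify_tensor (hk.dirDeriv (e j)) (hU i) (h.measurable i),
      ae_tendsto_mollify_tensor (hk.dirDeriv (e j)) (hφU i) (hφUm i)] with z h1 h2 h3
    simp only [hd, hds]
    exact (h1.const_mul _).add ((h2.const_mul _).add h3)
  have hmeas1 : ∀ i m, AEStronglyMeasurable
      (mollify (tensor (kernel ℝ m) (kernel (Space d) n)) (U i)) := fun i m =>
    ((hM m).contDiff_mollify (hU i)).continuous.aestronglyMeasurable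
  have hsm : ∀ i m, ContDiff ℝ ∞
      (symMollify (tensor (kernel ℝ m) (kernel (Space d) n)) φ (U i)) := fun i m =>
    (hφ.smooth.mul ((hM m).contDiff_mollify (hU i))).add ((hM m).contDiff_mollify (hφU i))
  have hmeas3 : ∀ i j m, AEStronglyMeasurable (dirDeriv (0, e j)
      (symMollify (tensor (kernel ℝ m) (kernel (Space d) n)) φ (U i))) := fun i j m =>
    (((hsm i m).continuous_fderiv (by simp)).clm_apply continuous_const).aestronglyMeasurable
  have hb3 : ∀ i j, ∃ D, ∀ m z, |dirDeriv (0, e j)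
      (symMollify (tensor (kernel ℝ m) (kernel (Space d) n)) φ (U i)) z| ≤ D := fun i j => by
    obtain ⟨B, hB0, hB⟩ := (hφ.dirDeriv (0, e j)).exists_bound
    refine ⟨B * (C * ∫ y, |kernel (Space d) n y|)
      + (A * (C * ∫ y, |dirDeriv (e j) (kernel (Space d) n) y|)
      + A * C * ∫ y, |dirDeriv (e j) (kernel (Space d) n) y|), fun m z => ?_⟩
    rw [hd]
    refine (abs_add_le _ _).trans (add_le_add ?_ ((abs_add_le _ _).trans (add_le_add ?_ ?_)))
    · rw [abs_mul]
      exact mul_le_mul (hB z) (hb hk (h.bound i) m z) (abs_nonneg _) hB0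
    · rw [abs_mul]
      exact mul_le_mul (hA z) (hb (hk.dirDeriv _) (h.bound i) m z) (abs_nonneg _) hA0
    · exact hb (hk.dirDeriv _) (hφUb i) m z
  have hl := tendsto_finsetSum (Finset.univ : Finset (Fin d)) fun i _ =>
    (((tendsto_integral_mul_of_bounded ((hφ.dirDeriv (1, 0)).integrable_mul (hU i)) (hmeas1 i)
      (hb hk (h.bound i)) (hlim1 i)).add
    (tendsto_finsetSum (Finset.univ : Finset (Fin d)) fun j _ =>
      tendsto_integral_mul_of_bounded (h.integrable_mul i j) (hmeas3 i j) (hb3 i j).choose_spec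
        (hlim3 i j))).add
    (tendsto_integral_mul_of_bounded h.integrable_pressure (hmeas3 i i) (hb3 i i).choose_spec
        (hlim3 i i))).add
    (tendsto_integral_mul_of_bounded (h.integrable_force i)
      (fun m => (hsm i m).continuous.aestronglyMeasurable)
      (fun m z => abs_symMollify_le (hM m).integrable (h.bound i) hA z |>.trans
        (by rw [integral_abs_tensor, integral_abs_kernel, integral_abs_kernel])) (hlim2 i))
  refine tendsto_nhds_unique hl (tendsto_const_nhds.congr' ?_)
  filter_upwards [eventually_ge_atTop n] with m hm
  exact (h.energy_mollified_tensor hφ hm hO).symm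

end IsLocalSolution

end SpaceTime

/-! ### Almost every time slice is divergence free. -/

section SliceDivergence

variable {d : ℕ}

namespace IsLocalSolution

variable {O : Set (Space d)} {T C : ℝ} {U : Fin d → ℝ × Space d → ℝ}
  {P : ℝ × Space d → ℝ} {F : Fin d → ℝ × Space d → ℝ} {φ : ℝ × Space d → ℝ}

theorem slice_eq_zero (h : IsLocalSolution O T C U P F) (i : Fin d) {t : ℝ} (ht : t ∉ Ioo 0 T) :
    slice (U i) t = 0 :=
  funext fun x => h.eq_zero i (t, x) fun hz => ht hz.1

/-- The space-time constraint is tested with `θ t * k (x - y)` for arbitrary `θ`; the fundamental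
lemma of the calculus of variations in time concludes. -/
theorem ae_sum_mollify_dirDeriv_eq_zero (h : IsLocalSolution O T C U P F) (n : ℕ) {x : Space d}
    (hx : Metric.closedBall x ((n : ℝ) + 1)⁻¹ ⊆ O) :
    ∀ᵐ t : ℝ, ∑ j, mollify (dirDeriv (e j) (kernel (Space d) n)) (slice (U j) t) x = 0 := by
  have hk := kernel_isTest (E := Space d) n
  have hi : ∀ j, Integrable fun t =>
      mollify (dirDeriv (e j) (kernel (Space d) n)) (slice (U j) t) x := fun j =>
    integrable_mollify_slice (hk.dirDeriv (e j)) (h.integrable j) x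
  have hsum : Integrable fun t =>
      ∑ j, mollify (dirDeriv (e j) (kernel (Space d) n)) (slice (U j) t) x :=
    integrable_finsetSum _ fun j _ => hi j
  have key := IsOpen.ae_eq_zero_of_integral_contDiff_smul_eq_zero (isOpen_Ioo (a := (0 : ℝ)) (b := T))
    (hsum.locallyIntegrable.locallyIntegrableOn _) ?_
  · filter_upwards [key] with t ht
    by_cases htI : t ∈ Ioo 0 T
    · exact ht htI
    · simp [h.slice_eq_zero _ htI, mollify]
  · intro θ hθ hθc hθs
    have hθt : IsTest (Ioo 0 T) θ := ⟨hθ, hθc, hθs⟩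
    have ht := hθt.tensor (hk.sub_left x)
    have h0 := h.div _ (ht.mono (prod_mono_right hx))
    obtain ⟨B, -, hB⟩ := hθt.exists_bound
    have e1 : ∀ j, ∫ z, U j z * dirDeriv (0, e j) (tensor θ fun y => kernel (Space d) n (x - y)) z
        = - ∫ t, θ t * mollify (dirDeriv (e j) (kernel (Space d) n)) (slice (U j) t) x := by
      intro j
      have hint : Integrable (fun z => U j z
          * dirDeriv (0, e j) (tensor θ fun y => kernel (Space d) n (x - y)) z) := by
        simpa only [mul_comm] using (ht.dirDeriv (0, e j)).integrable_mul (h.integrable j)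
      rw [Measure.volume_eq_prod, integral_prod _ hint, ← integral_neg]
      refine integral_congr_ae (Eventually.of_forall fun t => ?_)
      simp only [mollify]
      rw [← integral_const_mul, ← integral_neg]
      refine integral_congr_ae (Eventually.of_forall fun y => ?_)
      simp only
      rw [dirDeriv_tensor hθt.differentiable (hk.sub_left x).differentiable]
      simp only [tensor, slice]
      rw [dirDeriv_sub_left hk.differentiable]
      ring
    simp only [e1, Finset.sum_neg_distrib, neg_eq_zero] at h0
    rw [← h0, ← integral_finsetSum _ fun j _ => (hi j).bdd_mul
      hθt.continuous.aestronglyMeasurable (Eventually.of_forall hB)]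
    simp [Finset.mul_sum]

/-- The null set of times must not depend on `ζ`. It is chosen for the mollified divergences,
indexed by the countable set of scales `n`; then, for each `ζ`, integration by parts and `n → ∞`
recover the constraint. -/
theorem ae_div_slice (h : IsLocalSolution O T C U P F) (hO : IsOpen O) :
    ∀ᵐ t : ℝ, ∀ ζ, IsTest O ζ → ∑ j, ∫ x, slice (U j) t x * dirDeriv (e j) ζ x = 0 := by
  -- Taking the interior makes the set open, hence measurable; it still contains any given compact
  -- subset of `O` once `n` is large.
  let B : ℕ → Set (Space d) := fun n => interior {x | Metric.closedBall x ((n : ℝ) + 1)⁻¹ ⊆ O}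
  have hae : ∀ᵐ t : ℝ, ∀ n, ∀ᵐ x : Space d, x ∈ B n →
      ∑ j, mollify (dirDeriv (e j) (kernel (Space d) n)) (slice (U j) t) x = 0 := by
    refine ae_all_iff.2 fun n => ?_
    have hk := kernel_isTest (E := Space d) n
    refine (Measure.ae_ae_comm ?_).2 (Eventually.of_forall fun x => ?_)
    · have hm : StronglyMeasurable fun z : ℝ × Space d =>
          ∑ j, mollify (dirDeriv (e j) (kernel (Space d) n)) (slice (U j) z.1) z.2 :=
        Finset.stronglyMeasurable_fun_sum _ fun j _ =>
          stronglyMeasurable_mollify_slice (hk.dirDeriv (e j)).continuous (h.measurable j)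
      have h1 : MeasurableSet {z : ℝ × Space d | z.2 ∈ B n} :=
        isOpen_interior.measurableSet.preimage measurable_snd
      have h2 := measurableSet_eq_fun hm.measurable (measurable_const (a := (0 : ℝ)))
      have : {z : ℝ × Space d | z.2 ∈ B n →
          ∑ j, mollify (dirDeriv (e j) (kernel (Space d) n)) (slice (U j) z.1) z.2 = 0}
          = {z | z.2 ∈ B n}ᶜ ∪ {z |
          ∑ j, mollify (dirDeriv (e j) (kernel (Space d) n)) (slice (U j) z.1) z.2 = 0} := by
        ext z
        simp [imp_iff_not_or]
      rw [this]
      exact h1.compl.union h2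
    · by_cases hx : x ∈ B n
      · exact (h.ae_sum_mollify_dirDeriv_eq_zero n (interior_subset hx)).mono fun t ht _ => ht
      · exact Eventually.of_forall fun t hx' => absurd hx' hx
  filter_upwards [hae] with t ht ζ hζ
  have hb : ∀ j x, |slice (U j) t x| ≤ C := fun j x => h.bound j _
  obtain ⟨δ, hδ, hδO⟩ := (hζ.compact : IsCompact (tsupport ζ)).exists_thickening_subset_open hO
    hζ.subset
  have hsub : ∀ᶠ n : ℕ in atTop, tsupport ζ ⊆ B n := by
    refine ((tendsto_kernel_radius).eventually_lt_const (half_pos hδ)).mono fun n hn x hx => ?_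
    refine mem_interior.2 ⟨Metric.ball x (δ / 2), fun y hy z hz => hδO ?_, Metric.isOpen_ball,
      Metric.mem_ball_self (half_pos hδ)⟩
    refine Metric.mem_thickening_iff.2 ⟨x, hx, ?_⟩
    calc dist z x ≤ dist z y + dist y x := dist_triangle _ _ _
      _ < δ / 2 + δ / 2 := add_lt_add_of_le_of_lt ((Metric.mem_closedBall.1 hz).trans hn.le) hy
      _ = δ := add_halves δ
  have hl : Tendsto (fun n => ∑ j, ∫ x, dirDeriv (e j) ζ x
      * mollify (kernel (Space d) n) (slice (U j) t) x) atTop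
      (𝓝 (∑ j, ∫ x, dirDeriv (e j) ζ x * slice (U j) t x)) :=
    tendsto_finsetSum _ fun j _ => tendsto_integral_mul_of_bounded
      (hζ.dirDeriv (e j)).integrable (fun n => ((kernel_isTest n).contDiff_mollify
        (h.integrable_slice j t)).continuous.aestronglyMeasurable)
      (fun n x => abs_mollify_kernel_le (hb j) n x)
      (ae_tendsto_mollify_kernel (h.integrable_slice j t).locallyIntegrable)
  simp only [mul_comm (slice _ t _)]
  refine tendsto_nhds_unique hl (tendsto_const_nhds.congr' ?_)
  filter_upwards [hsub] with n hn
  have hk := kernel_isTest (E := Space d) n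
  have hcd : ∀ j, ContDiff ℝ ∞ (mollify (kernel (Space d) n) (slice (U j) t)) := fun j =>
    hk.contDiff_mollify (h.integrable_slice j t)
  have hcd' : ∀ j, ContDiff ℝ ∞
      (mollify (dirDeriv (e j) (kernel (Space d) n)) (slice (U j) t)) := fun j =>
    (hk.dirDeriv _).contDiff_mollify (h.integrable_slice j t)
  have e1 : ∀ j, ∫ x, dirDeriv (e j) ζ x * mollify (kernel (Space d) n) (slice (U j) t) x
      = - ∫ x, ζ x * mollify (dirDeriv (e j) (kernel (Space d) n)) (slice (U j) t) x := by
    intro j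
    have hdm := hk.dirDeriv_mollify (h.integrable_slice j t) (e j)
    have hbp := integral_mul_fderiv_eq_neg_fderiv_mul_of_integrable (μ := (volume : Measure (Space d)))
      (f := ζ) (g := mollify (kernel (Space d) n) (slice (U j) t)) (v := e j)
      ((hζ.dirDeriv (e j)).mul_right (hcd j)).integrable
      (by
        have := (hζ.mul_right (hcd' j)).integrable
        rw [← hdm] at this
        exact this)
      (hζ.mul_right (hcd j)).integrable
      (fun x _ => hζ.differentiable x) (fun x _ => (hcd j).differentiable (by simp) x)
    rw [← hdm]
    simp only [dirDeriv] at hbp ⊢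
    rw [hbp, neg_neg]
  simp only [e1, Finset.sum_neg_distrib]
  rw [← integral_finsetSum _ fun j _ => (hζ.mul_right (hcd' j)).integrable, eq_comm, neg_eq_zero]
  refine integral_eq_zero_of_ae ((ht n).mono fun x hx => ?_)
  simp only [← Finset.mul_sum, Pi.zero_apply]
  by_cases hxs : x ∈ tsupport ζ
  · rw [hx (hn hxs), mul_zero]
  · rw [image_eq_zero_of_notMem_tsupport hxs, zero_mul]

end IsLocalSolution

end SliceDivergence

/-! ### The mollified energy balance and its limit. -/

section EnergyBalance

variable {d : ℕ}

/-- The kinetic energy density. -/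
noncomputable def kinetic (U : Fin d → ℝ × Space d → ℝ) (z : ℝ × Space d) : ℝ :=
  (∑ j, U j z * U j z) / 2

namespace IsLocalSolution

variable {O : Set (Space d)} {T C : ℝ} {U : Fin d → ℝ × Space d → ℝ}
  {P : ℝ × Space d → ℝ} {F : Fin d → ℝ × Space d → ℝ} {φ : ℝ × Space d → ℝ}

theorem slice_dirDeriv (hφ : IsTest univ φ) (v : Space d) (t : ℝ) :
    dirDeriv v (slice φ t) = slice (dirDeriv (0, v) φ) t :=
  funext fun x => dirDeriv_slice hφ.differentiable v t x

theorem dirDeriv_symMollify_slice (h : IsLocalSolution O T C U P F) (hφ : IsTest univ φ) (n : ℕ)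
    (i j : Fin d) (z : ℝ × Space d) :
    dirDeriv (e j) (symMollify (kernel (Space d) n) (slice φ z.1) (slice (U i) z.1)) z.2
      = dirDeriv (0, e j) φ z * mollify (kernel (Space d) n) (slice (U i) z.1) z.2
        + symMollify (dirDeriv (e j) (kernel (Space d) n)) (slice φ z.1) (slice (U i) z.1) z.2 := by
  rw [dirDeriv_symMollify (kernel_isTest n) ((hφ.slice z.1).mono (subset_univ _))
    (h.integrable_slice i z.1), dirDeriv_slice hφ.differentiable]
  rfl

theorem stronglyMeasurable_dirDeriv_symMollify (h : IsLocalSolution O T C U P F)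
    (hφ : IsTest univ φ) (n : ℕ) (i j : Fin d) : StronglyMeasurable fun z : ℝ × Space d =>
      dirDeriv (e j) (symMollify (kernel (Space d) n) (slice φ z.1) (slice (U i) z.1)) z.2 := by
  have hk := kernel_isTest (E := Space d) n
  simp only [h.dirDeriv_symMollify_slice hφ]
  exact ((hφ.dirDeriv _).continuous.stronglyMeasurable.mul
    (stronglyMeasurable_mollify_slice hk.continuous (h.measurable i))).add
    (stronglyMeasurable_symMollify_slice (hk.dirDeriv _).continuous hφ.continuous (h.measurable i))

theorem exists_bound_dirDeriv_symMollify (h : IsLocalSolution O T C U P F)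
    (hφ : IsTest univ φ) (n : ℕ) (i j : Fin d) : ∃ D, ∀ z : ℝ × Space d,
      |dirDeriv (e j) (symMollify (kernel (Space d) n) (slice φ z.1) (slice (U i) z.1)) z.2| ≤ D := by
  have hk := kernel_isTest (E := Space d) n
  obtain ⟨A, hA0, hA⟩ := hφ.exists_bound
  obtain ⟨B, hB0, hB⟩ := (hφ.dirDeriv (0, e j)).exists_bound
  refine ⟨B * C + 2 * (A * (C * ∫ y, |dirDeriv (e j) (kernel (Space d) n) y|)), fun z => ?_⟩
  rw [h.dirDeriv_symMollify_slice hφ]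
  refine (abs_add_le _ _).trans (add_le_add ?_ ?_)
  · rw [abs_mul]
    exact mul_le_mul (hB z) (abs_mollify_kernel_le (fun x => h.bound i _) n _) (abs_nonneg _) hB0
  · exact abs_symMollify_le (hk.dirDeriv _).integrable (fun x => h.bound i _) (fun x => hA _) _

theorem integrable_mul_dirDeriv_symMollify (h : IsLocalSolution O T C U P F)
    (hφ : IsTest univ φ) (n : ℕ) (i j : Fin d) {R : ℝ × Space d → ℝ} (hR : Integrable R) :
    Integrable fun z : ℝ × Space d => R z *
      dirDeriv (e j) (symMollify (kernel (Space d) n) (slice φ z.1) (slice (U i) z.1)) z.2 := by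
  obtain ⟨D, hD⟩ := h.exists_bound_dirDeriv_symMollify hφ n i j
  exact hR.mul_bdd (h.stronglyMeasurable_dirDeriv_symMollify hφ n i j).aestronglyMeasurable
    (Eventually.of_forall hD)

theorem stronglyMeasurable_spaceMollify (h : IsLocalSolution O T C U P F) (hφ : IsTest univ φ)
    (n : ℕ) (i : Fin d) : StronglyMeasurable (spaceMollify n φ (U i)) :=
  stronglyMeasurable_symMollify_slice (kernel_isTest n).continuous hφ.continuous (h.measurable i)

theorem tendsto_integral_mul_spaceMollify (h : IsLocalSolution O T C U P F) (hφ : IsTest univ φ)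
    (i : Fin d) {R : ℝ × Space d → ℝ} (hR : Integrable R) :
    Tendsto (fun n => ∫ z, R z * spaceMollify n φ (U i) z) atTop
      (𝓝 (∫ z, R z * (2 * (φ z * U i z)))) := by
  obtain ⟨A, hA0, hA⟩ := hφ.exists_bound
  refine tendsto_integral_mul_of_bounded (C := 2 * (A * C)) hR
    (fun n => (h.stronglyMeasurable_spaceMollify hφ n i).aestronglyMeasurable)
    (fun n z => abs_symMollify_kernel_le (fun x => h.bound i _) (fun x => hA _) n _) ?_
  filter_upwards [ae_tendsto_mollify_slice (h.measurable i) (h.integrable_slice i)] with z hz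
  exact tendsto_symMollify_kernel (hφ.slice z.1) (h.integrable_slice i z.1) (fun x => h.bound i _)
    fun _ => hz

theorem integrable_kinetic (h : IsLocalSolution O T C U P F) : Integrable (kinetic U) :=
  (integrable_finsetSum _ fun j _ => h.integrable_mul j j).div_const 2

/-- Slicewise zero divergence moves the derivative from the kernel to `φ`. The factor `R` then needs
only integrability, which is all the pressure offers. -/
theorem sum_integral_mul_dirDeriv_symMollify (h : IsLocalSolution O T C U P F) (hO : IsOpen O)
    (hφ : IsTest univ φ) {n : ℕ}
    (hn : Metric.cthickening ((n : ℝ) + 1)⁻¹ (Prod.snd '' tsupport φ) ⊆ O)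
    {R : ℝ × Space d → ℝ} (hR : Integrable R) :
    ∑ i, ∫ z, R z *
        dirDeriv (e i) (symMollify (kernel (Space d) n) (slice φ z.1) (slice (U i) z.1)) z.2
      = ∑ i, ∫ z, R z * spaceMollify n (dirDeriv (0, e i) φ) (U i) z := by
  have hφ' : IsTest (tsupport φ) φ := ⟨hφ.smooth, hφ.compact, subset_rfl⟩
  have hI : ∀ i, Integrable fun z => R z * spaceMollify n (dirDeriv (0, e i) φ) (U i) z := by
    intro i
    obtain ⟨A, hA0, hA⟩ := (hφ.dirDeriv (0, e i)).exists_bound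
    exact hR.mul_bdd (h.stronglyMeasurable_spaceMollify (hφ.dirDeriv _) n i).aestronglyMeasurable
      (Eventually.of_forall fun z =>
        abs_symMollify_kernel_le (fun x => h.bound i _) (fun x => hA _) n _)
  rw [← integral_finsetSum _ fun i _ => h.integrable_mul_dirDeriv_symMollify hφ n i i hR,
    ← integral_finsetSum _ fun i _ => hI i]
  have hae : ∀ᵐ z : ℝ × Space d, ∀ ζ, IsTest O ζ →
      ∑ j, ∫ x, slice (U j) z.1 x * dirDeriv (e j) ζ x = 0 :=
    (Measure.quasiMeasurePreserving_fst (μ := (volume : Measure ℝ))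
      (ν := (volume : Measure (Space d)))).ae (h.ae_div_slice hO)
  refine integral_congr_ae (hae.mono fun z hz => ?_)
  simp only [← Finset.mul_sum]
  congr 1
  rw [sum_dirDeriv_symMollify (fun j => h.integrable_slice j z.1) e hz (kernel_isTest n)
    (hφ'.slice z.1) ((Metric.self_subset_cthickening _).trans hn)
    (fun x hx => (Metric.closedBall_subset_cthickening hx _).trans hn)]
  simp only [slice_dirDeriv hφ]
  rfl

/-- Adding the kinetic energy times the divergence of the test field completes the quadratic term to
`advectionDensity`. Every term on the left is then free of derivatives of the kernel. -/
theorem energy_mollified (h : IsLocalSolution O T C U P F) (hO : IsOpen O)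
    (hφ : IsTest univ φ) {n : ℕ}
    (hn : Metric.cthickening ((n : ℝ) + 1)⁻¹ (tsupport φ) ⊆ box O T)
    (hn' : Metric.cthickening ((n : ℝ) + 1)⁻¹ (Prod.snd '' tsupport φ) ⊆ O) :
    ∑ i, ((∫ z, (dirDeriv (1, 0) φ z * U i z)
          * mollify (kernel (Space d) n) (slice (U i) z.1) z.2)
      + (∫ z, kinetic U z * spaceMollify n (dirDeriv (0, e i) φ) (U i) z)
      + (∫ z, P z * spaceMollify n (dirDeriv (0, e i) φ) (U i) z)
      + ∫ z, F i z * spaceMollify n φ (U i) z)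
    = ∫ t, ∫ x, advectionDensity (fun i => slice (U i) t)
        (fun i => symMollify (kernel (Space d) n) (slice φ t) (slice (U i) t)) x := by
  have h0 := h.energy_mollified_slice hφ hn
  simp only [Finset.sum_add_distrib] at h0 ⊢
  rw [h.sum_integral_mul_dirDeriv_symMollify hO hφ hn' h.integrable_pressure] at h0
  rw [← h.sum_integral_mul_dirDeriv_symMollify hO hφ hn' h.integrable_kinetic]
  have hI1 : ∀ i j, Integrable fun z : ℝ × Space d => (U i z * U j z) * dirDeriv (e j)
      (symMollify (kernel (Space d) n) (slice φ z.1) (slice (U i) z.1)) z.2 := fun i j =>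
    h.integrable_mul_dirDeriv_symMollify hφ n i j (h.integrable_mul i j)
  have hI2 : ∀ i, Integrable fun z : ℝ × Space d => kinetic U z * dirDeriv (e i)
      (symMollify (kernel (Space d) n) (slice φ z.1) (slice (U i) z.1)) z.2 := fun i =>
    h.integrable_mul_dirDeriv_symMollify hφ n i i h.integrable_kinetic
  have hI3 : Integrable fun z : ℝ × Space d => ∑ i, (kinetic U z * dirDeriv (e i)
      (symMollify (kernel (Space d) n) (slice φ z.1) (slice (U i) z.1)) z.2
      - ∑ j, (U i z * U j z) * dirDeriv (e j)
      (symMollify (kernel (Space d) n) (slice φ z.1) (slice (U i) z.1)) z.2) :=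
    integrable_finsetSum _ fun i _ => (hI2 i).sub (integrable_finsetSum _ fun j _ => hI1 i j)
  have hadv : ∀ z : ℝ × Space d, advectionDensity (fun i => slice (U i) z.1)
      (fun i => symMollify (kernel (Space d) n) (slice φ z.1) (slice (U i) z.1)) z.2
      = ∑ i, (kinetic U z * dirDeriv (e i)
      (symMollify (kernel (Space d) n) (slice φ z.1) (slice (U i) z.1)) z.2
      - ∑ j, (U i z * U j z) * dirDeriv (e j)
      (symMollify (kernel (Space d) n) (slice φ z.1) (slice (U i) z.1)) z.2) := fun z => by
    simp only [advectionDensity, Finset.sum_sub_distrib, kinetic]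
    congr 1
    refine Finset.sum_congr rfl fun i _ => ?_
    rw [← Finset.sum_div, ← Finset.sum_mul]
    simp only [slice]
    ring
  have hint : ∫ t, ∫ x, advectionDensity (fun i => slice (U i) t)
        (fun i => symMollify (kernel (Space d) n) (slice φ t) (slice (U i) t)) x
      = (∑ i, ∫ z, kinetic U z * dirDeriv (e i)
        (symMollify (kernel (Space d) n) (slice φ z.1) (slice (U i) z.1)) z.2)
      - ∑ i, ∑ j, ∫ z, (U i z * U j z) * dirDeriv (e j)
        (symMollify (kernel (Space d) n) (slice φ z.1) (slice (U i) z.1)) z.2 := by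
    have hI4 := hI3
    simp only [← hadv] at hI4
    rw [← integral_prod (fun z : ℝ × Space d => advectionDensity (fun i => slice (U i) z.1)
      (fun i => symMollify (kernel (Space d) n) (slice φ z.1) (slice (U i) z.1)) z.2) hI4]
    simp only [hadv, ← Measure.volume_eq_prod]
    have hI5 : ∀ i, Integrable fun z : ℝ × Space d => kinetic U z * dirDeriv (e i)
        (symMollify (kernel (Space d) n) (slice φ z.1) (slice (U i) z.1)) z.2
        - ∑ j, (U i z * U j z) * dirDeriv (e j)
        (symMollify (kernel (Space d) n) (slice φ z.1) (slice (U i) z.1)) z.2 := fun i =>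
      (hI2 i).sub (integrable_finsetSum _ fun j _ => hI1 i j)
    rw [integral_finsetSum _ fun i _ => hI5 i,
      ← Finset.sum_sub_distrib]
    refine Finset.sum_congr rfl fun i _ => ?_
    rw [integral_sub (hI2 i) (integrable_finsetSum _ fun j _ => hI1 i j),
      integral_finsetSum _ fun j _ => hI1 i j]
  rw [hint]
  linarith

/-- Dominated convergence in time: the fixed-time limit is zero for almost every `t`, and the
derivative-free bound gives a multiple of `|Λ t|(O)` as dominating function. -/
theorem tendsto_integral_advectionDensity (h : IsLocalSolution O T C U P F) (hO : IsOpen O)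
    {Λ : ℝ → VectorMeasure (Space d) (Mat d)}
    (hs : ∀ᵐ t ∂(volume.restrict (Ioo 0 T)), IsSlice O C (fun i => slice (U i) t) (Λ t))
    (hΛ : ∫⁻ t in Ioo 0 T, (Λ t).variation O < ⊤) (hφ : IsTest (box O T) φ) :
    Tendsto (fun n => ∫ t, ∫ x, advectionDensity (fun i => slice (U i) t)
      (fun i => symMollify (kernel (Space d) n) (slice φ t) (slice (U i) t)) x) atTop (𝓝 0) := by
  have hφu := hφ.mono (subset_univ _)
  have hφ' : IsTest (tsupport φ) φ := ⟨hφ.smooth, hφ.compact, subset_rfl⟩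
  have hS : IsCompact (Prod.snd '' tsupport φ) := hφ.compact.image continuous_snd
  have hSO : Prod.snd '' tsupport φ ⊆ O := by
    rintro _ ⟨z, hz, rfl⟩
    exact (hφ.subset hz).2
  obtain ⟨δ, hδ, hδO⟩ := hS.exists_cthickening_subset_open hO hSO
  obtain ⟨N, hN⟩ := eventually_atTop.1
    ((tendsto_kernel_radius).eventually_lt_const hδ)
  obtain ⟨A, hA0, hA⟩ := hφ.exists_bound
  let H : ℕ → ℝ → ℝ := fun n t => ∫ x, advectionDensity (fun i => slice (U i) t)
    (fun i => symMollify (kernel (Space d) n) (slice φ t) (slice (U i) t)) x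
  have hHm : ∀ n, StronglyMeasurable (H n) := fun n => by
    have : StronglyMeasurable fun z : ℝ × Space d =>
        advectionDensity (fun i => slice (U i) z.1)
          (fun i => symMollify (kernel (Space d) n) (slice φ z.1) (slice (U i) z.1)) z.2 := by
      refine Finset.stronglyMeasurable_fun_sum _ fun i _ =>
        Finset.stronglyMeasurable_fun_sum _ fun j _ => ?_
      have h1 := h.stronglyMeasurable_dirDeriv_symMollify hφu n i i
      have h2 := h.stronglyMeasurable_dirDeriv_symMollify hφu n i j
      have hi := h.measurable i
      have hj := h.measurable j
      simp only [div_eq_mul_inv]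
      exact (((hj.mul hj).mul h1).mul stronglyMeasurable_const).sub ((hi.mul hj).mul h2)
    exact this.integral_prod_right
  have hH0 : ∀ n t, t ∉ Ioo 0 T → H n t = 0 := fun n t ht => by
    simp [H, advectionDensity, h.slice_eq_zero _ ht]
  have hlim : Tendsto (fun n => ∫⁻ t in Ioo 0 T, ‖H (n + N) t‖ₑ) atTop
      (𝓝 (∫⁻ _t in Ioo 0 T, 0)) := by
    -- `2 * (A * C)` bounds the symmetrized mollification and the last `C` bounds the precise value.
    refine tendsto_lintegral_of_dominated_convergence
      (fun t => (∑ _i : Fin d, ∑ _j : Fin d, ENNReal.ofReal (2 * (A * C) * C)) * (Λ t).variation O)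
      (fun n => (hHm _).measurable.enorm) (fun n => ?_) ?_ ?_
    · filter_upwards [hs] with t ht
      refine ht.enorm_integral_advectionDensity_le hO
        (hS.cthickening (r := (((n + N : ℕ) : ℝ) + 1)⁻¹))
        ((Metric.cthickening_mono (hN _ (Nat.le_add_left _ _)).le _).trans hδO)
        (fun i => (kernel_isTest _).symMollify hS (hφ'.slice t) (ht.integrable i))
        fun i x => abs_symMollify_kernel_le (ht.bound i) (fun x => hA _) _ x
    · have hc : (∑ _i : Fin d, ∑ _j : Fin d, ENNReal.ofReal (2 * (A * C) * C)) ≠ ⊤ := by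
        simp [ENNReal.mul_eq_top]
      rw [lintegral_const_mul' _ _ hc]
      exact ENNReal.mul_ne_top hc hΛ.ne
    · filter_upwards [hs] with t ht
      have h1 := ht.tendsto_integral_advectionDensity hO hS hSO (hφ'.slice t)
      have h2 := (continuous_enorm.tendsto _).comp ((tendsto_add_atTop_iff_nat N).2 h1)
      rw [Real.enorm_eq_ofReal_abs, abs_zero, ENNReal.ofReal_zero] at h2
      exact h2
  rw [lintegral_zero] at hlim
  rw [← tendsto_add_atTop_iff_nat N, tendsto_zero_iff_enorm_tendsto_zero]
  refine tendsto_of_tendsto_of_tendsto_of_le_of_le tendsto_const_nhds hlim (fun n => zero_le)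
    fun n => ?_
  change ‖∫ t, H (n + N) t‖ₑ ≤ _
  rw [← setIntegral_eq_integral_of_forall_compl_eq_zero (hH0 (n + N))]
  exact enorm_integral_le_lintegral_enorm _

theorem energy_balance (h : IsLocalSolution O T C U P F) (hO : IsOpen O)
    {Λ : ℝ → VectorMeasure (Space d) (Mat d)}
    (hs : ∀ᵐ t ∂(volume.restrict (Ioo 0 T)), IsSlice O C (fun i => slice (U i) t) (Λ t))
    (hΛ : ∫⁻ t in Ioo 0 T, (Λ t).variation O < ⊤) (hφ : IsTest (box O T) φ) :
    ∑ i, ((∫ z, (dirDeriv (1, 0) φ z * U i z) * U i z)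
      + (∫ z, kinetic U z * (2 * (dirDeriv (0, e i) φ z * U i z)))
      + (∫ z, P z * (2 * (dirDeriv (0, e i) φ z * U i z)))
      + ∫ z, F i z * (2 * (φ z * U i z))) = 0 := by
  have hφu := hφ.mono (subset_univ _)
  have hS : IsCompact (Prod.snd '' tsupport φ) := hφ.compact.image continuous_snd
  have hSO : Prod.snd '' tsupport φ ⊆ O := by
    rintro _ ⟨z, hz, rfl⟩
    exact (hφ.subset hz).2
  obtain ⟨δ, hδ, hδO⟩ := hS.exists_cthickening_subset_open hO hSO
  obtain ⟨δ', hδ', hδO'⟩ := (hφ.compact : IsCompact (tsupport φ)).exists_cthickening_subset_open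
    (isOpen_Ioo.prod hO) hφ.subset
  have hD := fun i => hφu.dirDeriv (0, e i)
  have h1 : ∀ i, Tendsto (fun n => ∫ z, (dirDeriv (1, 0) φ z * U i z)
      * mollify (kernel (Space d) n) (slice (U i) z.1) z.2) atTop
      (𝓝 (∫ z, (dirDeriv (1, 0) φ z * U i z) * U i z)) := fun i =>
    tendsto_integral_mul_of_bounded (C := C)
      ((hφ.dirDeriv (1, 0)).integrable_mul (h.integrable i))
      (fun n => (stronglyMeasurable_mollify_slice (kernel_isTest n).continuous
        (h.measurable i)).aestronglyMeasurable)
      (fun n z => abs_mollify_kernel_le (fun x => h.bound i _) n _)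
      (ae_tendsto_mollify_slice (h.measurable i) (h.integrable_slice i))
  have h2 := fun i => h.tendsto_integral_mul_spaceMollify (hD i) i h.integrable_kinetic
  have h3 := fun i => h.tendsto_integral_mul_spaceMollify (hD i) i h.integrable_pressure
  have h4 := fun i => h.tendsto_integral_mul_spaceMollify hφu i (h.integrable_force i)
  have hlim := tendsto_finsetSum (Finset.univ : Finset (Fin d)) fun i _ =>
    (((h1 i).add (h2 i)).add (h3 i)).add (h4 i)
  refine tendsto_nhds_unique (hlim.congr' ?_) (h.tendsto_integral_advectionDensity hO hs hΛ hφ)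
  filter_upwards [tendsto_kernel_radius.eventually_lt_const hδ,
    tendsto_kernel_radius.eventually_lt_const hδ'] with n h1 h2
  exact h.energy_mollified hO hφu ((Metric.cthickening_mono h2.le _).trans hδO')
    ((Metric.cthickening_mono h1.le _).trans hδO)

end IsLocalSolution

end EnergyBalance

/-! ### Evaluating distributions on test functions. -/

section Distributions

variable {X : Type*} [NormedAddCommGroup X] [NormedSpace ℝ X] {V : Opens X}

theorem isTest_testFunction (φ : 𝓓(V, ℝ)) : IsTest (V : Set X) φ :=
  ⟨φ.contDiff, φ.hasCompactSupport, φ.tsupport_subset⟩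

/-- A test function as an element of the space of test functions. -/
def IsTest.testFunction {ζ : X → ℝ} (hζ : IsTest (V : Set X) ζ) : 𝓓(V, ℝ) :=
  ⟨ζ, hζ.smooth, hζ.compact, hζ.subset⟩

theorem lineDeriv_testFunction_apply (v : X) (φ : 𝓓(V, ℝ)) (x : X) :
    (∂_{v} φ : 𝓓(V, ℝ)) x = dirDeriv v φ x := by
  rw [TestFunction.lineDerivOp_eq_lineDerivCLM ℝ, TestFunction.lineDerivCLM_apply_of_le (by simp),
    ((isTest_testFunction φ).differentiable x).lineDeriv_eq_fderiv]
  rfl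

variable [MeasureSpace X] [BorelSpace X] {g : X → ℝ}

theorem toDistribution_apply (hg : LocallyIntegrableOn g V) (φ : 𝓓(V, ℝ)) :
    toDistribution V g φ = ∫ x, g x * φ x := by
  change TestFunction.integralAgainstBilinCLM (ContinuousLinearMap.lsmul ℝ ℝ) volume g φ = _
  rw [TestFunction.integralAgainstBilinCLM_eq_integral hg]
  simp [mul_comm]

theorem lineDeriv_toDistribution_apply (hg : LocallyIntegrableOn g V) (v : X) (φ : 𝓓(V, ℝ)) :
    (∂_{v} (toDistribution V g) : 𝓓'(V, ℝ)) φ = - ∫ x, g x * dirDeriv v φ x := by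
  rw [Distribution.lineDerivOp_apply_apply, map_neg, toDistribution_apply hg]
  simp only [lineDeriv_testFunction_apply]

theorem integral_mul_congr_of_ae {B : Set X} {a b ζ : X → ℝ} (hab : ∀ᵐ x, x ∈ B → a x = b x)
    (hζ : IsTest B ζ) : ∫ x, a x * ζ x = ∫ x, b x * ζ x := by
  refine integral_congr_ae (hab.mono fun x hx => ?_)
  by_cases h : x ∈ B
  · simp only [hx h]
  · simp only [hζ.eq_zero h, mul_zero]

theorem locallyIntegrableOn_of_bound [IsLocallyFiniteMeasure (volume : Measure X)]
    (hg : AEStronglyMeasurable g (volume.restrict V)) {C : ℝ}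
    (hC : ∀ᵐ x ∂(volume.restrict (V : Set X)), |g x| ≤ C) : LocallyIntegrableOn g V :=
  locallyIntegrableOn_of_locallyIntegrable_restrict
    ((memLp_top_of_bound hg C hC).locallyIntegrable le_top)

end Distributions

/-! ### From blow ups to convergence of mollifications. -/

section BlowUp

variable {d : ℕ}

theorem ae_comp_add_smul {A : Space d → Prop} (hA : ∀ᵐ y, A y) (x : Space d) {ℓ : ℝ} (hℓ : ℓ ≠ 0) :
    ∀ᵐ z, A (x + ℓ • z) := by
  have h1 := (measurePreserving_add_left (volume : Measure (Space d)) x).quasiMeasurePreserving.ae hA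
  rw [ae_iff] at h1 ⊢
  have := Measure.addHaar_preimage_smul (volume : Measure (Space d)) hℓ {a | ¬ A (x + a)}
  rw [h1, mul_zero] at this
  exact this

/-- Blow ups are local: for small `ℓ` the rescaled ball stays in `O`, where `g` agrees almost
everywhere with the component of `w`. -/
theorem AdmitsBlowUp.exists_tendsto_mollify {w : Space d → Space d} {x : Space d}
    (h : AdmitsBlowUp w x) {O : Set (Space d)} (hO : IsOpen O) (hx : x ∈ O) {j : Fin d}
    {g : Space d → ℝ} (hg : Integrable g) (hwg : ∀ᵐ y, y ∈ O → g y = w y j) :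
    ∃ V, Tendsto (fun n => mollify (kernel (Space d) n) g x) atTop (𝓝 V) := by
  obtain ⟨v, hv, hlim⟩ := h
  refine ⟨_, tendsto_mollify_kernel_of_blowUp (v := fun z => v z j) hg
    ((EuclideanSpace.proj j : Space d →L[ℝ] ℝ).integrable_comp hv) ?_⟩
  obtain ⟨δ, hδ, hδO⟩ := Metric.isOpen_iff.1 hO x hx
  refine tendsto_of_tendsto_of_tendsto_of_le_of_le' tendsto_const_nhds hlim
    (Eventually.of_forall fun _ => zero_le) ?_
  filter_upwards [Ioo_mem_nhdsGT hδ] with ℓ hℓ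
  refine lintegral_mono_ae ?_
  refine (ae_restrict_iff' Metric.isOpen_ball.measurableSet).2
    ((ae_comp_add_smul hwg x hℓ.1.ne').mono fun z hz hzb => ?_)
  rw [hz (hδO _)]
  · rw [enorm_le_iff_norm_le]
    exact PiLp.norm_apply_le (w (x + ℓ • z) - v z) j
  · rw [Metric.mem_ball, dist_eq_norm, add_sub_cancel_left, norm_smul, Real.norm_eq_abs,
      abs_of_pos hℓ.1]
    rw [mem_ball_zero_iff] at hzb
    exact (mul_le_of_le_one_right hℓ.1.le hzb.le).trans_lt hℓ.2

end BlowUp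

/-! ### Bounded measurable representatives of the velocity. -/

section Truncation

variable {d : ℕ} {O : Set (Space d)} {T : ℝ} {u : ℝ × Space d → Space d}

/-- Cutting off a strongly measurable representative where its norm exceeds `C` changes it only on a
null set and yields a bound at every point, hence on every time slice. -/
theorem exists_truncation (hO : IsOpen O)
    (hu : AEStronglyMeasurable u (volume.restrict (box O T))) {C : ℝ}
    (hC : ∀ᵐ z ∂(volume.restrict (box O T)), ‖u z‖ ≤ C) (hC0 : 0 ≤ C) :
    ∃ U : Fin d → ℝ × Space d → ℝ, (∀ i, StronglyMeasurable (U i)) ∧ (∀ i z, |U i z| ≤ C) ∧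
      (∀ i, ∀ z ∉ box O T, U i z = 0) ∧ ∀ᵐ z, z ∈ box O T → ∀ i, U i z = u z i := by
  have hB : MeasurableSet (box O T) := (isOpen_Ioo.prod hO).measurableSet
  have hm := hu.stronglyMeasurable_mk
  have hG : MeasurableSet (box O T ∩ {z | ‖hu.mk u z‖ ≤ C}) :=
    hB.inter (measurableSet_le hm.norm.measurable measurable_const)
  refine ⟨fun i => (box O T ∩ {z | ‖hu.mk u z‖ ≤ C}).indicator fun z => hu.mk u z i,
    fun i => StronglyMeasurable.indicator
      ((EuclideanSpace.proj i : Space d →L[ℝ] ℝ).continuous.comp_stronglyMeasurable hm) hG,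
    fun i z => ?_, fun i z hz => indicator_of_notMem (fun h => hz h.1) _, ?_⟩
  · beta_reduce
    by_cases hz : z ∈ box O T ∩ {z | ‖hu.mk u z‖ ≤ C}
    · rw [indicator_of_mem hz]
      exact (PiLp.norm_apply_le (hu.mk u z) i).trans hz.2
    · rw [indicator_of_notMem hz, abs_zero]
      exact hC0
  · filter_upwards [(ae_restrict_iff' hB).1 hu.ae_eq_mk, (ae_restrict_iff' hB).1 hC] with z h1 h2 hz i
    have h3 : z ∈ box O T ∩ {z | ‖hu.mk u z‖ ≤ C} := ⟨hz, by
      rw [mem_ofPred_eq, ← h1 hz]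
      exact h2 hz⟩
    rw [indicator_of_mem h3, ← h1 hz]

theorem integrable_of_bound_box (hO : IsOpen O) (hOf : volume O < ⊤) {g : ℝ × Space d → ℝ}
    (hg : StronglyMeasurable g) {C : ℝ} (hC : ∀ z, |g z| ≤ C) (h0 : ∀ z ∉ box O T, g z = 0) :
    Integrable g := by
  have hB : MeasurableSet (box O T) := (isOpen_Ioo.prod hO).measurableSet
  have hfin : volume (box O T) < ⊤ := by
    rw [box, Measure.volume_eq_prod, Measure.prod_prod]
    exact ENNReal.mul_lt_top (by simp) hOf
  exact (Measure.integrableOn_of_bounded hfin.ne hg.aestronglyMeasurable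
    (Eventually.of_forall hC)).integrable_of_forall_notMem_eq_zero h0

theorem integrable_slice_of_bound_box (hOf : volume O < ⊤) {g : ℝ × Space d → ℝ}
    (hg : StronglyMeasurable g) {C : ℝ} (hC : ∀ z, |g z| ≤ C) (h0 : ∀ z ∉ box O T, g z = 0)
    (t : ℝ) : Integrable (slice g t) :=
  (Measure.integrableOn_of_bounded (s := O) hOf.ne
    (hg.comp_measurable measurable_prodMk_left).aestronglyMeasurable
    (Eventually.of_forall fun x => hC (t, x))).integrable_of_forall_notMem_eq_zero
    fun x hx => h0 (t, x) fun h => hx h.2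

end Truncation

/-! ### Localizing the weak solution and its time slices. -/

section Truncation

variable {d : ℕ} {Ω : Opens (Space d)} {O : Set (Space d)} {T C : ℝ}
  {u : ℝ → Space d → Space d} {p : ℝ → Space d → ℝ} {f : ℝ → Space d → Space d}
  {U : Fin d → ℝ × Space d → ℝ}

theorem IsTest.mono_cylinder {Ψ : ℝ × Space d → ℝ} (hΨ : IsTest (box O T) Ψ) (hOΩ : O ⊆ Ω) :
    IsTest (cylinder Ω T : Set (ℝ × Space d)) Ψ :=
  hΨ.mono (prod_mono_right hOΩ)

theorem aestronglyMeasurable_coord {X : Type*} [MeasurableSpace X] {ν : Measure X} {w : X → Space d}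
    (hw : AEStronglyMeasurable w ν) (i : Fin d) : AEStronglyMeasurable (fun x => w x i) ν :=
  (EuclideanSpace.proj i : Space d →L[ℝ] ℝ).continuous.comp_aestronglyMeasurable hw

theorem integrable_coord {X : Type*} [MeasurableSpace X] {ν : Measure X} {w : X → Space d}
    (hw : Integrable w ν) (i : Fin d) : Integrable (fun x => w x i) ν :=
  (EuclideanSpace.proj i : Space d →L[ℝ] ℝ).integrable_comp hw

theorem locallyIntegrableOn_coord {X : Type*} [NormedAddCommGroup X] [NormedSpace ℝ X]
    [MeasureSpace X] [BorelSpace X] [IsLocallyFiniteMeasure (volume : Measure X)] {V : Opens X}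
    {w : X → Space d} (hw : AEStronglyMeasurable w (volume.restrict V))
    (hC : ∀ᵐ x ∂(volume.restrict (V : Set X)), ‖w x‖ ≤ C) (i : Fin d) :
    LocallyIntegrableOn (fun x => w x i) V :=
  locallyIntegrableOn_of_bound (aestronglyMeasurable_coord hw i)
    (hC.mono fun x hx => (PiLp.norm_apply_le (w x) i).trans hx)

theorem locallyIntegrableOn_coord_mul {X : Type*} [NormedAddCommGroup X] [NormedSpace ℝ X]
    [MeasureSpace X] [BorelSpace X] [IsLocallyFiniteMeasure (volume : Measure X)] {V : Opens X}
    {w : X → Space d} (hw : AEStronglyMeasurable w (volume.restrict V))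
    (hC : ∀ᵐ x ∂(volume.restrict (V : Set X)), ‖w x‖ ≤ C) (i j : Fin d) :
    LocallyIntegrableOn (fun x => w x i * w x j) V :=
  locallyIntegrableOn_of_bound (C := C * C)
    ((aestronglyMeasurable_coord hw i).mul (aestronglyMeasurable_coord hw j))
    (hC.mono fun x hx => by
      rw [abs_mul]
      exact mul_le_mul ((PiLp.norm_apply_le (w x) i).trans hx)
        ((PiLp.norm_apply_le (w x) j).trans hx) (abs_nonneg _) ((norm_nonneg _).trans hx))

theorem IsWeakSolution.isLocalSolution (hsol : IsWeakSolution Ω T u p f) (hO : IsOpen O)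
    (hOΩ : O ⊆ Ω) (hOf : volume O < ⊤)
    (hu : AEStronglyMeasurable (fun z : ℝ × Space d => u z.1 z.2)
      (volume.restrict (cylinder Ω T)))
    (hC : ∀ᵐ z ∂(volume.restrict (cylinder Ω T : Set (ℝ × Space d))), ‖u z.1 z.2‖ ≤ C)
    (hp : IntegrableOn (fun z : ℝ × Space d => p z.1 z.2) (cylinder Ω T))
    (hf : IntegrableOn (fun z : ℝ × Space d => f z.1 z.2) (cylinder Ω T))
    (hUm : ∀ i, StronglyMeasurable (U i)) (hUC : ∀ i z, |U i z| ≤ C)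
    (hU0 : ∀ i, ∀ z ∉ box O T, U i z = 0)
    (hUu : ∀ᵐ z : ℝ × Space d, z ∈ box O T → ∀ i, U i z = u z.1 z.2 i) :
    IsLocalSolution O T C U ((box O T).indicator fun z => p z.1 z.2)
      (fun i => (box O T).indicator fun z => f z.1 z.2 i) := by
  have hB : MeasurableSet (box O T) := (isOpen_Ioo.prod hO).measurableSet
  have hBQ : box O T ⊆ (cylinder Ω T : Set (ℝ × Space d)) := prod_mono_right hOΩ
  have hfi := fun i => integrable_coord hf i
  have hUi : ∀ i, ∀ᵐ z : ℝ × Space d, z ∈ box O T → U i z = u z.1 z.2 i := fun i =>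
    hUu.mono fun z hz h => hz h i
  have hUij : ∀ i j, ∀ᵐ z : ℝ × Space d, z ∈ box O T →
      U i z * U j z = u z.1 z.2 i * u z.1 z.2 j := fun i j =>
    hUu.mono fun z hz h => by rw [hz h i, hz h j]
  have hlu := fun i => locallyIntegrableOn_coord hu hC i
  refine ⟨hUm, fun i => integrable_of_bound_box hO hOf (hUm i) (hUC i) (hU0 i),
    fun i t => integrable_slice_of_bound_box hOf (hUm i) (hUC i) (hU0 i) t, hUC, hU0,
    (integrable_indicator_iff hB).2 (hp.mono_set hBQ),
    fun i => (integrable_indicator_iff hB).2 (IntegrableOn.mono_set (hfi i) hBQ), fun i Ψ hΨ => ?_, fun Ψ hΨ => ?_⟩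
  · have h := DFunLike.congr_fun (hsol.momentum i) (hΨ.mono_cylinder hOΩ).testFunction
    simp only [add_apply, sum_apply, dt, dx] at h
    rw [lineDeriv_toDistribution_apply (hlu i), lineDeriv_toDistribution_apply hp.locallyIntegrableOn,
      toDistribution_apply (IntegrableOn.locallyIntegrableOn (hfi i))] at h
    simp only [lineDeriv_toDistribution_apply (locallyIntegrableOn_coord_mul hu hC i _)] at h
    rw [integral_mul_congr_of_ae (hUi i) (hΨ.dirDeriv _),
      integral_mul_congr_of_ae (a := (box O T).indicator _) (b := fun z => p z.1 z.2)
        (Eventually.of_forall fun z hz => indicator_of_mem hz _) (hΨ.dirDeriv _),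
      integral_mul_congr_of_ae (a := (box O T).indicator _) (b := fun z => f z.1 z.2 i)
        (Eventually.of_forall fun z hz => indicator_of_mem hz _) hΨ,
      Finset.sum_congr rfl fun j _ => integral_mul_congr_of_ae (hUij i j) (hΨ.dirDeriv _)]
    rw [Finset.sum_neg_distrib] at h
    have h'' : ((hΨ.mono_cylinder hOΩ).testFunction : ℝ × Space d → ℝ) = Ψ := rfl
    simp only [h''] at h
    linarith
  · have h := DFunLike.congr_fun hsol.incompressible (hΨ.mono_cylinder hOΩ).testFunction
    simp only [sum_apply, dx, lineDeriv_toDistribution_apply (hlu _)] at h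
    rw [Finset.sum_neg_distrib] at h
    rw [Finset.sum_congr rfl fun j _ => integral_mul_congr_of_ae (hUi j) (hΨ.dirDeriv _)]
    exact neg_eq_zero.1 h

theorem ae_isSlice {P : ℝ × Space d → ℝ} {F : Fin d → ℝ × Space d → ℝ}
    {Λ : ℝ → VectorMeasure (Space d) (Mat d)} (h : IsLocalSolution O T C U P F) (hO : IsOpen O)
    (hOΩ : O ⊆ Ω)
    (hu : AEStronglyMeasurable (fun z : ℝ × Space d => u z.1 z.2)
      (volume.restrict (cylinder Ω T)))
    (hC : ∀ᵐ z ∂(volume.restrict (cylinder Ω T : Set (ℝ × Space d))), ‖u z.1 z.2‖ ≤ C)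
    (hUu : ∀ᵐ z : ℝ × Space d, z ∈ box O T → ∀ i, U i z = u z.1 z.2 i)
    (hgrad : ∀ᵐ t ∂(volume.restrict (Ioo 0 T)), IsAntisymmGradient Ω (u t) (Λ t))
    (hN : ∀ᵐ t ∂(volume.restrict (Ioo 0 T)), (Λ t).variation (noBlowUpSet Ω (u t)) = 0) :
    ∀ᵐ t ∂(volume.restrict (Ioo 0 T)), IsSlice O C (fun i => slice (U i) t) (Λ t) := by
  have hQ : (volume.restrict (cylinder Ω T : Set (ℝ × Space d)))
      = (volume.restrict (Ioo 0 T)).prod (volume.restrict (Ω : Set (Space d))) :=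
    (Measure.prod_restrict _ _).symm
  rw [hQ] at hu hC
  have hUu' : ∀ᵐ t : ℝ, ∀ᵐ x : Space d, (t, x) ∈ box O T → ∀ i, U i (t, x) = u t x i :=
    Measure.ae_ae_of_ae_prod hUu
  filter_upwards [hgrad, hN, ae_restrict_of_ae (h.ae_div_slice hO), ae_restrict_of_ae hUu',
    hu.prodMk_left, Measure.ae_ae_of_ae_prod hC, ae_restrict_mem measurableSet_Ioo]
    with t hg hn hd hU hm hb htI
  have hUx : ∀ i, ∀ᵐ x : Space d, x ∈ O → slice (U i) t x = u t x i := fun i =>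
    hU.mono fun x hx hxO => hx ⟨htI, hxO⟩ i
  refine ⟨fun i => h.integrable_slice i t, fun i x => h.bound i _, hd, fun i j ζ hζ => ?_, ?_⟩
  · have h1 := hg i j (hζ.mono hOΩ).testFunction
    rw [sub_apply,
      lineDeriv_toDistribution_apply (locallyIntegrableOn_coord hm hb i),
      lineDeriv_toDistribution_apply (locallyIntegrableOn_coord hm hb j)] at h1
    rw [integral_mul_congr_of_ae (hUx i) (hζ.dirDeriv _),
      integral_mul_congr_of_ae (hUx j) (hζ.dirDeriv _), componentIntegral]
    have h'' : ((hζ.mono hOΩ).testFunction : Space d → ℝ) = ζ := rfl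
    simp only [h''] at h1
    linarith
  · have hn' : ∀ᵐ x ∂(Λ t).variation, x ∉ noBlowUpSet Ω (u t) := by
      rw [ae_iff]
      simpa using hn
    filter_upwards [hn'] with x hx hxO j
    have hx' : AdmitsBlowUp (u t) x := by
      by_contra hcon
      exact hx ⟨hOΩ hxO, hcon⟩
    exact hx'.exists_tendsto_mollify hO hxO (h.integrable_slice j t) (hUx j)

end Truncation

/-! ### From the localized balance to the defect distribution. -/

section Conclusion

variable {d : ℕ} {Ω : Opens (Space d)} {O : Set (Space d)} {T C : ℝ}
  {u : ℝ → Space d → Space d} {p : ℝ → Space d → ℝ} {f : ℝ → Space d → Space d}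
  {U : Fin d → ℝ × Space d → ℝ} {P : ℝ × Space d → ℝ} {F : Fin d → ℝ × Space d → ℝ}

theorem IsLocalSolution.integral_energy_eq (h : IsLocalSolution O T C U P F)
    {φ : ℝ × Space d → ℝ} (hφ : IsTest (box O T) φ) :
    2 * ((∫ z, (∑ i, F i z * U i z) * φ z) + (∫ z, kinetic U z * dirDeriv (1, 0) φ z)
      + ∑ i, ∫ z, (U i z * (kinetic U z + P z)) * dirDeriv (0, e i) φ z)
    = ∑ i, ((∫ z, (dirDeriv (1, 0) φ z * U i z) * U i z)
      + (∫ z, kinetic U z * (2 * (dirDeriv (0, e i) φ z * U i z)))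
      + (∫ z, P z * (2 * (dirDeriv (0, e i) φ z * U i z)))
      + ∫ z, F i z * (2 * (φ z * U i z))) := by
  have hb : ∀ {R ψ : ℝ × Space d → ℝ} (i : Fin d), Integrable R → IsTest (box O T) ψ →
      Integrable fun z => R z * (2 * (ψ z * U i z)) := fun {R ψ} i hR hψ => by
    have h1 := hR.mul_bdd (c := C) (h.measurable i).aestronglyMeasurable
      (Eventually.of_forall (h.bound i))
    refine ((hψ.integrable_mul h1).const_mul 2).congr (Eventually.of_forall fun z => ?_)
    simp only
    ring
  have hF : ∀ i, Integrable fun z => F i z * (2 * (φ z * U i z)) := fun i =>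
    hb i (h.integrable_force i) hφ
  have hK : ∀ i, Integrable fun z => kinetic U z * (2 * (dirDeriv (0, e i) φ z * U i z)) :=
    fun i => hb i h.integrable_kinetic (hφ.dirDeriv _)
  have hP : ∀ i, Integrable fun z => P z * (2 * (dirDeriv (0, e i) φ z * U i z)) := fun i =>
    hb i h.integrable_pressure (hφ.dirDeriv _)
  have hD : ∀ i, Integrable fun z => (dirDeriv (1, 0) φ z * U i z) * U i z := fun i => by
    simpa only [mul_assoc] using (hφ.dirDeriv (1, 0)).integrable_mul (h.integrable_mul i i)
  simp only [Finset.sum_add_distrib]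
  rw [← integral_finsetSum _ fun i _ => hD i, ← integral_finsetSum _ fun i _ => hF i, mul_add,
    mul_add, ← integral_const_mul, ← integral_const_mul, Finset.mul_sum]
  have e1 : ∀ i, 2 * ∫ z, (U i z * (kinetic U z + P z)) * dirDeriv (0, e i) φ z
      = (∫ z, kinetic U z * (2 * (dirDeriv (0, e i) φ z * U i z)))
        + ∫ z, P z * (2 * (dirDeriv (0, e i) φ z * U i z)) := fun i => by
    rw [← integral_const_mul, ← integral_add (hK i) (hP i)]
    refine integral_congr_ae (Eventually.of_forall fun z => ?_)
    simp only
    ring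
  have e2 : ∫ z, 2 * ((∑ i, F i z * U i z) * φ z) = ∫ z, ∑ i, F i z * (2 * (φ z * U i z)) := by
    refine integral_congr_ae (Eventually.of_forall fun z => ?_)
    simp only [Finset.sum_mul, Finset.mul_sum]
    exact Finset.sum_congr rfl fun i _ => by ring
  have e3 : ∫ z, 2 * (kinetic U z * dirDeriv (1, 0) φ z)
      = ∫ z, ∑ i, (dirDeriv (1, 0) φ z * U i z) * U i z := by
    refine integral_congr_ae (Eventually.of_forall fun z => ?_)
    simp only [kinetic, mul_assoc, ← Finset.mul_sum]
    ring
  simp only [e1, e2, e3, Finset.sum_add_distrib]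
  ring

theorem dissipation_apply
    (hu : AEStronglyMeasurable (fun z : ℝ × Space d => u z.1 z.2)
      (volume.restrict (cylinder Ω T)))
    (hC : ∀ᵐ z ∂(volume.restrict (cylinder Ω T : Set (ℝ × Space d))), ‖u z.1 z.2‖ ≤ C)
    (hp : IntegrableOn (fun z : ℝ × Space d => p z.1 z.2) (cylinder Ω T))
    (hf : IntegrableOn (fun z : ℝ × Space d => f z.1 z.2) (cylinder Ω T))
    (φ : 𝓓(cylinder Ω T, ℝ)) :
    dissipation Ω T u p f φ = (∫ z, inner ℝ (f z.1 z.2) (u z.1 z.2) * φ z)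
      + (∫ z, (‖u z.1 z.2‖ ^ 2 / 2) * dirDeriv (1, 0) φ z)
      + ∑ i, ∫ z, (u z.1 z.2 i * (‖u z.1 z.2‖ ^ 2 / 2 + p z.1 z.2)) * dirDeriv (0, e i) φ z := by
  have hK : AEStronglyMeasurable (fun z : ℝ × Space d => ‖u z.1 z.2‖ ^ 2 / 2)
      (volume.restrict (cylinder Ω T)) :=
    ((continuous_pow 2).div_const 2).comp_aestronglyMeasurable hu.norm
  have hKC : ∀ᵐ z ∂(volume.restrict (cylinder Ω T : Set (ℝ × Space d))),
      |‖u z.1 z.2‖ ^ 2 / 2| ≤ C ^ 2 / 2 := hC.mono fun z hz => by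
    rw [abs_of_nonneg (by positivity)]
    gcongr
  have hi : IntegrableOn (fun z : ℝ × Space d => inner ℝ (f z.1 z.2) (u z.1 z.2))
      (cylinder Ω T) := by
    refine (hf.norm.mul_const C).mono' (hf.aestronglyMeasurable.inner hu) (hC.mono fun z hz => ?_)
    exact (norm_inner_le_norm _ _).trans (mul_le_mul_of_nonneg_left hz (norm_nonneg _))
  have hE : ∀ i, LocallyIntegrableOn
      (fun z : ℝ × Space d => u z.1 z.2 i * (‖u z.1 z.2‖ ^ 2 / 2 + p z.1 z.2)) (cylinder Ω T) := by
    intro i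
    have hKl := locallyIntegrableOn_of_bound (C := C * (C ^ 2 / 2))
      ((aestronglyMeasurable_coord hu i).mul hK) (by
        filter_upwards [hC, hKC] with z h1 h2
        rw [Pi.mul_apply, abs_mul]
        exact mul_le_mul ((PiLp.norm_apply_le (u z.1 z.2) i).trans h1) h2 (abs_nonneg _)
          ((norm_nonneg _).trans h1))
    have hpl : IntegrableOn (fun z : ℝ × Space d => u z.1 z.2 i * p z.1 z.2) (cylinder Ω T) :=
      hp.bdd_mul (c := C) (aestronglyMeasurable_coord hu i)
        (hC.mono fun z hz => (PiLp.norm_apply_le (u z.1 z.2) i).trans hz)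
    simp only [mul_add]
    exact hKl.add hpl.locallyIntegrableOn
  rw [dissipation, sub_apply, sub_apply, sum_apply, dt]
  simp only [dx]
  rw [toDistribution_apply hi.locallyIntegrableOn,
    lineDeriv_toDistribution_apply (locallyIntegrableOn_of_bound hK hKC)]
  simp only [lineDeriv_toDistribution_apply (hE _), Finset.sum_neg_distrib, sub_neg_eq_add]

/-- For each test function the problem is restricted to a relatively compact base `O` containing the
spatial projection of its support. Finite volume makes the truncated bounded velocity integrable,
even when `Ω` has infinite measure. -/
theorem dissipation_apply_eq_zero (Λ : ℝ → VectorMeasure (Space d) (Mat d))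
    (hu : MemLp (fun z : ℝ × Space d => u z.1 z.2) ⊤
      (volume.restrict (cylinder Ω T)))
    (hp : IntegrableOn (fun z : ℝ × Space d => p z.1 z.2)
      (cylinder Ω T))
    (hf : IntegrableOn (fun z : ℝ × Space d => f z.1 z.2)
      (cylinder Ω T))
    (hsol : IsWeakSolution Ω T u p f)
    (hΛ : MemL1Measures Ω T Λ)
    (hgrad : ∀ᵐ t ∂(volume.restrict (Ioo 0 T)), IsAntisymmGradient Ω (u t) (Λ t))
    (hN : ∀ᵐ t ∂(volume.restrict (Ioo 0 T)),
      (Λ t).variation (noBlowUpSet Ω (u t)) = 0)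
    (φ : 𝓓(cylinder Ω T, ℝ)) :
    dissipation Ω T u p f φ = 0 := by
  have hC : ∀ᵐ z ∂(volume.restrict (cylinder Ω T : Set (ℝ × Space d))),
      ‖u z.1 z.2‖ ≤ (eLpNorm (fun z : ℝ × Space d => u z.1 z.2) ⊤
        (volume.restrict (cylinder Ω T))).toReal := by
    filter_upwards [ae_le_eLpNormEssSup (f := fun z : ℝ × Space d => u z.1 z.2)
      (μ := volume.restrict (cylinder Ω T))] with z hz
    rw [← eLpNorm_exponent_top] at hz
    rw [← toReal_enorm]
    exact ENNReal.toReal_mono hu.2.ne hz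
  have hφ := isTest_testFunction φ
  obtain ⟨O, hO, hSO, hOΩ, hOc⟩ := exists_open_between_and_isCompact_closure
    ((hφ.compact : IsCompact (tsupport φ)).image continuous_snd) Ω.isOpen
    (by
      rintro _ ⟨z, hz, rfl⟩
      exact (hφ.subset hz).2)
  have hOΩ' : O ⊆ Ω := subset_closure.trans hOΩ
  have hOf : volume O < ⊤ := (measure_mono subset_closure).trans_lt hOc.measure_lt_top
  have hφO : IsTest (box O T) φ :=
    ⟨hφ.smooth, hφ.compact, fun z hz => ⟨(hφ.subset hz).1, hSO (mem_image_of_mem _ hz)⟩⟩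
  have hBQ : box O T ⊆ (cylinder Ω T : Set (ℝ × Space d)) := prod_mono_right hOΩ'
  obtain ⟨U, hUm, hUC, hU0, hUu⟩ := exists_truncation (T := T) hO (hu.1.mono_set hBQ)
    (ae_mono (Measure.restrict_mono_set _ hBQ) hC) ENNReal.toReal_nonneg
  have h := hsol.isLocalSolution hO hOΩ' hOf hu.1 hC hp hf hUm hUC hU0 hUu
  have hbal := h.energy_balance hO (ae_isSlice h hO hOΩ' hu.1 hC hUu hgrad hN)
    ((lintegral_mono fun t => measure_mono hOΩ').trans_lt hΛ.integrableNorm) hφO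
  rw [← h.integral_energy_eq hφO] at hbal
  have hkin : ∀ᵐ z : ℝ × Space d, z ∈ box O T → ‖u z.1 z.2‖ ^ 2 / 2 = kinetic U z :=
    hUu.mono fun z hz hzB => by
      rw [EuclideanSpace.real_norm_sq_eq]
      simp only [kinetic, hz hzB, pow_two]
  rw [dissipation_apply hu.1 hC hp hf, integral_mul_congr_of_ae hkin (hφO.dirDeriv _),
    integral_mul_congr_of_ae (b := fun z => ∑ i, (box O T).indicator (fun z => f z.1 z.2 i) z
      * U i z) (hUu.mono fun z hz hzB => ?_) hφO,
    Finset.sum_congr rfl fun i _ => integral_mul_congr_of_ae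
      (b := fun z => U i z * (kinetic U z + (box O T).indicator (fun z => p z.1 z.2) z))
      ?_ (hφO.dirDeriv _)]
  · linarith
  · filter_upwards [hUu, hkin] with z h1 h2 hzB
    rw [h1 hzB, h2 hzB, indicator_of_mem hzB]
  · simp only [indicator_of_mem hzB, hz hzB, PiLp.inner_apply]
    exact Finset.sum_congr rfl fun i _ => mul_comm _ _

end Conclusion

end EulerEnergy

theorem theorem4p4 {d : ℕ} (Ω : TopologicalSpace.Opens (EulerEnergy.Space d)) (T : ℝ)
    (u : ℝ → EulerEnergy.Space d → EulerEnergy.Space d)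
    (p : ℝ → EulerEnergy.Space d → ℝ)
    (f : ℝ → EulerEnergy.Space d → EulerEnergy.Space d)
    (Λ : ℝ → VectorMeasure (EulerEnergy.Space d) (EulerEnergy.Mat d))
    (hu : MemLp (fun z : ℝ × EulerEnergy.Space d => u z.1 z.2) ∞
      (volume.restrict (EulerEnergy.cylinder Ω T)))
    (hp : IntegrableOn (fun z : ℝ × EulerEnergy.Space d => p z.1 z.2)
      (EulerEnergy.cylinder Ω T))
    (hf : IntegrableOn (fun z : ℝ × EulerEnergy.Space d => f z.1 z.2)
      (EulerEnergy.cylinder Ω T))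
    (hsol : EulerEnergy.IsWeakSolution Ω T u p f)
    (hΛ : EulerEnergy.MemL1Measures Ω T Λ)
    (hgrad : ∀ᵐ t ∂(volume.restrict (Ioo 0 T)), EulerEnergy.IsAntisymmGradient Ω (u t) (Λ t))
    (hN : ∀ᵐ t ∂(volume.restrict (Ioo 0 T)),
      (Λ t).variation (EulerEnergy.noBlowUpSet Ω (u t)) = 0) :
    EulerEnergy.dissipation Ω T u p f = 0 := by
  ext φ
  exact EulerEnergy.dissipation_apply_eq_zero Λ hu hp hf hsol hΛ hgrad hN φ
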